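/- **Conventions.** Let $T$ be a perfect tract with nullset $N_T$ and let $E$ be a finite set. (A tract is a commutative monoid $T$ with zero and unit group $T^\times=T\setminus\{0\}$, together with an ideal $N_T$ of the semiring $\mathbb N[T^\times]$ such that for every $a\in T$ there is a unique element $-a\in T$ with $a+(-a)\in N_T$.) Functions $X_1,\dots,X_k:E\to T$ are *linearly dependent* if there are $c_1,\dots,c_k\in T$, not all $0$, with $c_1X_1(e)+\dots+c_kX_k(e)\in N_T$ for all $e\in E$. A *$T$-matroid of rank $r$ on $E$* is the class $[\varphi]$, modulo multiplication by $T^\times$, of a function $\varphi:E^r\to T$ that is alternating, for which the sets $\{e_1,\dots,e_r\}$ with $\varphi(e_1,\dots,e_r)\neq0$ are the bases of a matroid $M_\varphi$ on $E$ (its *underlying matroid*), and that satisfies the 3-term Plücker relations $$\varphi(x,a,b)\varphi(x,c,d)-\varphi(x,a,c)\varphi(x,b,d)+\varphi(x,a,d)\varphi(x,b,c)\in N_T$$ for all $x\in E^{r-2}$ and $a,b,c,d\in E$. Its *vectors* are the functions $X:E\to T$ with $\sum_{e\in E}X(e)\varphi(i_1,\dots,i_{r-1},e)\in N_T$ for all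 $i_1,\dots,i_{r-1}\in E$ (no condition if $r=0$), and its *covectors* are the vectors of the dual $T$-matroid $[\varphi^*]$, where $\varphi^*(d_1,\dots,d_{n-r})=\operatorname{sign}(d_1,\dots,d_{n-r},e_1,\dots,e_r)\,\varphi(e_1,\dots,e_r)$ if $E=\{d_1,\dots,d_{n-r},e_1,\dots,e_r\}$ with $n=\#E$ (the sign being that of this enumeration relative to a fixed total order of $E$), and $\varphi^*(d_1,\dots,d_{n-r})=0$ if the $d_i$ are not pairwise distinct. That $T$ is *perfect* means that for every $T$-matroid on every finite set, $\sum_e X(e)Y(e)\in N_T$ for all vectors $X$ and all covectors $Y$. Let $M$ be a matroid on $E$. A *hyperplane function* for a hyperplane $H$ of $M$ is a function $\eta_H:E\to T$ with support $E\setminus H$; it is nonzero and thus defines a $T$-matroid $[\eta_H]$ of rank $1$. A *modular triple* is a triple of pairwise distinct hyperplanes of $M$ whose intersection is a flat of corank $2$. A *$T$-representation* of $M$ is a family $(\eta_H)$ of hyperplane functions, one for every hyperplane $H$ of $M$, such that $\eta_{H_1},\eta_{H_2},\eta_{H_3}$ are linearly dependent for every modular triple; it is a $T$-representation *for* $[\varphi]$,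 of rank $r$, if $M=M_\varphi$ and $$\frac{\eta_H(d)}{\eta_H(e)}=\frac{\varphi(i_1,\dots,i_{r-1},d)}{\varphi(i_1,\dots,i_{r-1},e)}$$ whenever $i_1,\dots,i_{r-1}$ span $H$ and $d,e\in E\setminus H$. A $T$-matroid $[\varphi]$ is a *matroid quotient* of a $T$-matroid $[\psi]$ on the same set $E$ if the functions $\eta_H$ of a $T$-representation for $[\varphi]$ are covectors of $[\psi]$. **Lemma.** Let $T$ be a perfect tract, $M$ a matroid on the finite set $E$, and $F$ a flat of $M$ of corank $2$. For every hyperplane $H$ of $M$ with $F\subseteq H$ let $\eta_H:E\to T$ be a hyperplane function for $H$. Then the following are equivalent: 1. $\eta_{H_1},\eta_{H_2},\eta_{H_3}$ are linearly dependent for every modular triple $(H_1,H_2,H_3)$ of hyperplanes of $M$ with $H_1\cap H_2\cap H_3=F$; 2. there is a $T$-matroid $[\varphi]$ of rank $2$ on $E$ such that $[\eta_H]$ is a matroid quotient of $[\varphi]$ for every hyperplane $H\supseteq F$ of $M$. There is at most one $T$-matroid $[\varphi]$ as in (2), and if it exists, then its underlying matroid is $M_\varphi=(M/F)\oplus U_{0,F}$,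 where $U_{0,F}$ is the matroid of rank $0$ on $F$. -/

import Mathlib

noncomputable section

/-! ### Tracts -/

open Classical in
/-- The embedding of a pointed group `T` (a commutative monoid with zero whose unit group is
`T - {0}`) into its ambient semiring `ℕ[Tˣ]`: zero goes to zero and a nonzero element `a` goes to
the formal sum `1.a`. -/
def ambient {T : Type*} [CommGroupWithZero T] (a : T) : MonoidAlgebra ℕ Tˣ :=
  if h : a = 0 then 0 else MonoidAlgebra.single (Units.mk0 a h) 1

/-- An (ideal) tract: a pointed group together with an ideal of its ambient semiring
(the nullset) such that every element has a unique additive inverse with respect to it. -/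
class Tract (T : Type*) extends CommGroupWithZero T where
  nullset : Ideal (MonoidAlgebra ℕ Tˣ)
  existsUnique_neg : ∀ a : T, ∃! b : T, ambient a + ambient b ∈ nullset

theorem ambient_zero {T : Type*} [CommGroupWithZero T] : ambient (0 : T) = 0 := by
  simp [ambient]

theorem ambient_mul {T : Type*} [CommGroupWithZero T] (a b : T) :
    ambient (a * b) = ambient a * ambient b := by
  by_cases ha : a = 0
  · simp [ambient, ha]
  by_cases hb : b = 0
  · simp [ambient, hb]
  simp only [ambient, ha, hb, mul_ne_zero ha hb, dif_neg, not_false_eq_true,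
    MonoidAlgebra.single_mul_single, mul_one]
  congr 1
  ext
  simp

namespace Tract

/-- The additive inverse `-a` of an element of a tract. -/
def neg {T : Type*} [Tract T] (a : T) : T :=
  (Tract.existsUnique_neg a).choose

/-- A sign, as an element `1` or `-1` of the tract. -/
def ofSign (T : Type*) [Tract T] (s : ℤˣ) : T :=
  if s = 1 then 1 else neg 1

/-- The functions `X i : E → T` are linearly dependent: some combination with coefficients that are
not all zero lies pointwise in the nullset. -/
def LinDep {T E ι : Type*} [Tract T] [Fintype ι] (X : ι → E → T) : Prop :=
  ∃ c : ι → T, c ≠ 0 ∧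
    ∀ e, ∑ i, ambient (c i * X i e) ∈ (Tract.nullset : Ideal (MonoidAlgebra ℕ Tˣ))

/-- Orthogonality of functions `X, Y : E → T`. -/
def Orthogonal {T E : Type*} [Tract T] [Fintype E] (X Y : E → T) : Prop :=
  ∑ e, ambient (X e * Y e) ∈ (Tract.nullset : Ideal (MonoidAlgebra ℕ Tˣ))

end Tract

/-! ### Flats of small corank -/

namespace Matroid

/-- `F` is a flat of `M` of corank `k` (for matroids of finite rank). -/
def IsFlatOfCorank {E : Type*} (M : Matroid E) (k : ℕ) (F : Set E) : Prop :=
  M.IsFlat F ∧ M.eRk F + k = M.eRank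

/-- A hyperplane is a flat of corank one. -/
def IsHyperplane {E : Type*} (M : Matroid E) (H : Set E) : Prop :=
  M.IsFlatOfCorank 1 H

/-- Three pairwise distinct hyperplanes that intersect in a flat of corank two. -/
def IsModularTriple {E : Type*} (M : Matroid E) (H₁ H₂ H₃ : Set E) : Prop :=
  M.IsHyperplane H₁ ∧ M.IsHyperplane H₂ ∧ M.IsHyperplane H₃ ∧
    H₁ ≠ H₂ ∧ H₁ ≠ H₃ ∧ H₂ ≠ H₃ ∧ M.IsFlatOfCorank 2 (H₁ ∩ H₂ ∩ H₃)

/-- The direct sum `(M / F) ⊕ U_{0,F}`: contract `F`, then add its elements back as loops. -/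
def contractAddLoops {E : Type*} (M : Matroid E) (F : Set E) : Matroid E :=
  (M ／ F).disjointSum (Matroid.loopyOn F) (by
    simpa using Set.disjoint_sdiff_left)

theorem IsHyperplane.ne_univ {E : Type*} [Finite E] {M : Matroid E} {H : Set E}
    (h : M.IsHyperplane H) : H ≠ Set.univ := by
  rintro rfl
  have hE : M.E = Set.univ := Set.eq_univ_of_univ_subset h.1.subset_ground
  have h2 := h.2
  rw [← hE, ← Matroid.eRank_def] at h2
  have hfin : M.eRank ≠ ⊤ := by
    have := M.eRank_le_encard_ground
    exact (lt_of_le_of_lt this (Set.toFinite M.E).encard_lt_top).ne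
  lift M.eRank to ℕ using hfin with n
  norm_cast at h2
  omega

end Matroid

/-- `X` is a hyperplane function for the hyperplane `H`: its support is the complement of `H`. -/
def IsHyperplaneFunction {T E : Type*} [Tract T] (M : Matroid E) (H : Set E) (X : E → T) : Prop :=
  M.IsHyperplane H ∧ Function.support X = Hᶜ

theorem IsHyperplaneFunction.ne_zero {T E : Type*} [Tract T] [Finite E] {M : Matroid E}
    {H : Set E} {X : E → T} (h : IsHyperplaneFunction M H X) : X ≠ 0 := by
  rintro rfl
  have h2 := h.2
  rw [Function.support_zero, eq_comm, Set.compl_empty_iff] at h2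
  exact h.1.ne_univ h2

/-! ### Grassmann-Plücker functions and `T`-matroids -/

/-- The sets `{e₁, …, e_r}` with `φ (e₁, …, e_r) ≠ 0`. -/
def IsGPBase {T E : Type*} [Tract T] {r : ℕ} (φ : (Fin r → E) → T) (B : Set E) : Prop :=
  ∃ e : Fin r → E, φ e ≠ 0 ∧ Set.range e = B

/-- (Weak) Grassmann-Plücker functions of rank `r` on `E` with coefficients in `T`. For `r < 2`
there are no Plücker relations. -/
structure IsGrassmannPlucker {T E : Type*} [Tract T] {r : ℕ} (φ : (Fin r → E) → T) : Prop where
  exists_base : ∃ B, IsGPBase φ B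
  exchange : Matroid.ExchangeProperty (IsGPBase φ)
  map_perm : ∀ (σ : Equiv.Perm (Fin r)) (e : Fin r → E),
    φ (e ∘ σ) = Tract.ofSign T (Equiv.Perm.sign σ) * φ e
  map_of_not_injective : ∀ e : Fin r → E, ¬ Function.Injective e → φ e = 0
  plucker : ∀ (k : ℕ) (h : r = k + 2) (x : Fin k → E) (a b c d : E),
    ambient (φ (Fin.append x ![a, b] ∘ Fin.cast h) * φ (Fin.append x ![c, d] ∘ Fin.cast h)) +
      ambient (Tract.neg
        (φ (Fin.append x ![a, c] ∘ Fin.cast h) * φ (Fin.append x ![b, d] ∘ Fin.cast h))) +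
      ambient (φ (Fin.append x ![a, d] ∘ Fin.cast h) * φ (Fin.append x ![b, c] ∘ Fin.cast h))
        ∈ (Tract.nullset : Ideal (MonoidAlgebra ℕ Tˣ))

/-- The type of Grassmann-Plücker functions of rank `r` on `E`. -/
abbrev GPFunction (T E : Type*) [Tract T] (r : ℕ) :=
  {φ : (Fin r → E) → T // IsGrassmannPlucker φ}

/-- Two Grassmann-Plücker functions are equivalent if they differ by a unit of `T`. -/
instance gpSetoid (T E : Type*) [Tract T] (r : ℕ) : Setoid (GPFunction T E r) where
  r φ ψ := ∃ a : Tˣ, ∀ x, ψ.1 x = a * φ.1 x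
  iseqv := by
    refine ⟨fun φ => ⟨1, by simp⟩, ?_, ?_⟩
    · rintro φ ψ ⟨a, h⟩
      exact ⟨a⁻¹, fun x => by simp [h]⟩
    · rintro φ ψ χ ⟨a, h⟩ ⟨b, h'⟩
      exact ⟨b * a, fun x => by simp [h, h', mul_assoc]⟩

/-- A (weak) `T`-matroid of rank `r` on `E`: a class `[φ]` of Grassmann-Plücker functions modulo
the action of `Tˣ`. -/
def TMatroid (T E : Type*) [Tract T] (r : ℕ) := Quotient (gpSetoid T E r)

/-- The underlying matroid of a Grassmann-Plücker function, on the ground set `E`, with bases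
the sets `{e₁, …, e_r}` for which `φ (e₁, …, e_r) ≠ 0`. -/
def GPFunction.matroid {T E : Type*} [Tract T] [Finite E] {r : ℕ} (φ : GPFunction T E r) :
    Matroid E :=
  Matroid.ofIsBaseOfFinite (E := Set.univ) Set.finite_univ (IsGPBase φ.1) φ.2.exists_base
    φ.2.exchange (fun B _ => Set.subset_univ B)

theorem IsGPBase.of_equiv {T E : Type*} [Tract T] {r : ℕ} {φ ψ : (Fin r → E) → T} {a : Tˣ}
    (h : ∀ x, ψ x = a * φ x) : IsGPBase ψ = IsGPBase φ := by
  funext B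
  simp [IsGPBase, h]

/-- The underlying matroid of a `T`-matroid. -/
def TMatroid.matroid {T E : Type*} [Tract T] [Finite E] {r : ℕ} (P : TMatroid T E r) :
    Matroid E :=
  Quotient.lift (fun φ : GPFunction T E r => φ.matroid) (by
    rintro φ ψ ⟨a, h⟩
    apply Matroid.ext_isBase
    · rfl
    · intro B _
      change IsGPBase φ.1 B ↔ IsGPBase ψ.1 B
      rw [IsGPBase.of_equiv h]) P

theorem isGrassmannPlucker_of_ne_zero {T E : Type*} [Tract T] {X : E → T} (hX : X ≠ 0) :
    IsGrassmannPlucker (r := 1) (fun e : Fin 1 → E => X (e 0)) where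
  exists_base := by
    obtain ⟨e, he⟩ := Function.ne_iff.1 hX
    exact ⟨_, fun _ => e, he, rfl⟩
  exchange := by
    rintro _ _ ⟨e, he, rfl⟩ ⟨f, hf, rfl⟩ a ha
    have hr : ∀ g : Fin 1 → E, Set.range g = {g 0} := fun g => by
      rw [Set.range_unique]; rfl
    rw [hr, hr] at *
    obtain ⟨rfl, hne⟩ := ha
    refine ⟨f 0, ⟨rfl, fun h => hne (by simpa using Eq.symm h)⟩, f, hf, ?_⟩
    simp [hr]
  map_perm := by
    intro σ e
    have h0 : σ 0 = 0 := Subsingleton.elim _ _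
    have h1 : σ = 1 := Subsingleton.elim _ _
    simp [h1, Tract.ofSign]
  map_of_not_injective := fun e h => absurd (Function.injective_of_subsingleton e) h
  plucker := fun k h => absurd h (by omega)

/-- The `T`-matroid `[X]` of rank one of a nonzero function `X : E → T`. -/
def TMatroid.ofFunction {T E : Type*} [Tract T] (X : E → T) (hX : X ≠ 0) : TMatroid T E 1 :=
  Quotient.mk (gpSetoid T E 1) ⟨fun e => X (e 0), isGrassmannPlucker_of_ne_zero hX⟩

/-! ### Duality, vectors and covectors -/

/-- The sign of an enumeration of `E`, relative to a total ordering of `E` that is chosen once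
and for all. -/
def enumerationSign {E : Type*} [Fintype E] {m : ℕ} (f : Fin m → E) (hf : Function.Bijective f) :
    ℤˣ :=
  have hm : Fintype.card E = m := by
    simpa using (Fintype.card_of_bijective hf).symm
  Equiv.Perm.sign
    ((finCongr hm).trans ((Equiv.ofBijective f hf).trans (Fintype.equivFin E)))

open Classical in
/-- The dual `φ*` of a Grassmann-Plücker function: it sends `(d₁, …, d_{n-r})` to
`sign (d₁, …, d_{n-r}, e₁, …, e_r) * φ (e₁, …, e_r)` where `e₁, …, e_r` enumerate the complement
of `d₁, …, d_{n-r}` (in any order), and to `0` if `d₁, …, d_{n-r}` are not pairwise distinct. -/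
def gpDual {T E : Type*} [Tract T] [Fintype E] {r : ℕ} (φ : (Fin r → E) → T) :
    (Fin (Fintype.card E - r) → E) → T := fun d =>
  if h : ∃ e : Fin r → E, Function.Bijective (Fin.append d e) then
    Tract.ofSign T (enumerationSign _ h.choose_spec) * φ h.choose
  else 0

/-- The vectors of `φ`: the functions `X` with `∑ₑ X(e) φ(i₁, …, i_{r-1}, e)` in the nullset for
all `i₁, …, i_{r-1}`. For `r = 0` there is no condition. -/
def gpVectors {T E : Type*} [Tract T] [Fintype E] {r : ℕ} (φ : (Fin r → E) → T) : Set (E → T) :=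
  {X | ∀ (k : ℕ) (h : r = k + 1) (i : Fin k → E),
    Tract.Orthogonal X (fun e => φ (Fin.append i ![e] ∘ Fin.cast h))}

theorem gpVectors_smul {T E : Type*} [Tract T] [Fintype E] {r : ℕ} {φ ψ : (Fin r → E) → T}
    {a : Tˣ} (h : ∀ x, ψ x = a * φ x) : gpVectors φ ⊆ gpVectors ψ := by
  intro X hX k hk i
  have := hX k hk i
  unfold Tract.Orthogonal at *
  have h2 := Ideal.mul_mem_left _ (ambient (a : T)) this
  rw [Finset.mul_sum] at h2
  simpa only [h, ← ambient_mul, mul_left_comm] using h2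

theorem gpVectors_eq {T E : Type*} [Tract T] [Fintype E] {r : ℕ} {φ ψ : (Fin r → E) → T}
    {a : Tˣ} (h : ∀ x, ψ x = a * φ x) : gpVectors φ = gpVectors ψ :=
  (gpVectors_smul h).antisymm (gpVectors_smul (a := a⁻¹) (fun x => by simp [h]))

theorem gpDual_smul {T E : Type*} [Tract T] [Fintype E] {r : ℕ} {φ ψ : (Fin r → E) → T}
    {a : Tˣ} (h : ∀ x, ψ x = a * φ x) (d : Fin (Fintype.card E - r) → E) :
    gpDual ψ d = a * gpDual φ d := by
  unfold gpDual
  split_ifs <;> simp [h, mul_left_comm]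

/-- The set of vectors of a `T`-matroid. -/
def TMatroid.vectors {T E : Type*} [Tract T] [Fintype E] {r : ℕ} (P : TMatroid T E r) :
    Set (E → T) :=
  Quotient.lift (fun φ : GPFunction T E r => gpVectors φ.1) (by
    rintro φ ψ ⟨a, h⟩
    exact gpVectors_eq h) P

/-- The set of covectors of a `T`-matroid: the vectors of its dual. -/
def TMatroid.covectors {T E : Type*} [Tract T] [Fintype E] {r : ℕ} (P : TMatroid T E r) :
    Set (E → T) :=
  Quotient.lift (fun φ : GPFunction T E r => gpVectors (gpDual φ.1)) (by
    rintro φ ψ ⟨a, h⟩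
    exact gpVectors_eq (gpDual_smul h)) P

/-- A tract is perfect if vectors are orthogonal to covectors for all `T`-matroids (on all finite
ground sets). -/
def Tract.IsPerfect (T : Type*) [Tract T] : Prop :=
  ∀ (E : Type) [Fintype E] (r : ℕ) (P : TMatroid T E r),
    ∀ X ∈ P.vectors, ∀ Y ∈ P.covectors, Tract.Orthogonal X Y

/-! ### `T`-representations and matroid quotients -/

/-- `T`-representations of a matroid `M`: families of hyperplane functions that are linearly
dependent on modular triples. -/
structure IsTRepresentation {T E : Type*} [Tract T] (M : Matroid E)
    (η : {H : Set E // M.IsHyperplane H} → E → T) : Prop where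
  hyperplaneFunction : ∀ H, IsHyperplaneFunction M H.1 (η H)
  linDep : ∀ H₁ H₂ H₃, M.IsModularTriple H₁.1 H₂.1 H₃.1 → Tract.LinDep ![η H₁, η H₂, η H₃]

/-- The fundamental relation between `[φ]` and a family of functions indexed by hyperplanes:
`η_H(d) / η_H(e) = φ(i₁, …, i_{r-1}, d) / φ(i₁, …, i_{r-1}, e)` whenever `i₁, …, i_{r-1}` span
`H` and `d, e` are not in `H`. -/
def TMatroid.FundamentalRelation {T E : Type*} [Tract T] {r : ℕ}
    (P : TMatroid T E r) (M : Matroid E) (η : {H : Set E // M.IsHyperplane H} → E → T) : Prop :=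
  Quotient.lift (fun φ : GPFunction T E r =>
    ∀ (H : {H : Set E // M.IsHyperplane H}) (k : ℕ) (h : r = k + 1) (i : Fin k → E),
      M.closure (Set.range i) = H.1 → ∀ d ∉ H.1, ∀ e ∉ H.1,
        η H d / η H e =
          φ.1 (Fin.append i ![d] ∘ Fin.cast h) / φ.1 (Fin.append i ![e] ∘ Fin.cast h)) (by
    rintro φ ψ ⟨a, h⟩
    simp only [h, mul_div_mul_left _ _ a.ne_zero]) P

/-- `η` is a `T`-representation for the `T`-matroid `P`. -/
def TMatroid.IsRepresentedBy {T E : Type*} [Tract T] [Finite E] {r : ℕ} (P : TMatroid T E r)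
    (η : {H : Set E // P.matroid.IsHyperplane H} → E → T) : Prop :=
  IsTRepresentation P.matroid η ∧ P.FundamentalRelation P.matroid η

/-- `P` is a (matroid) quotient of `Q`: the hyperplane functions of a `T`-representation for `P`
are covectors of `Q`. (Two `T`-representations for `P` differ only by units, so that the choice
of `η` is irrelevant.) -/
def TMatroid.IsQuotientOf {T E : Type*} [Tract T] [Fintype E] {r s : ℕ}
    (P : TMatroid T E r) (Q : TMatroid T E s) : Prop :=
  ∃ η : {H : Set E // P.matroid.IsHyperplane H} → E → T,
    P.IsRepresentedBy η ∧ Set.range η ⊆ Q.covectors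

end

/-! The hyperplanes containing F cut E \ F into disjoint nonempty classes, one class H \ F for each
H; `IsPencil` records this for the functions η_H. In rank two, Y is a covector of [φ] exactly when
Y(a)φ(b,c) - Y(b)φ(a,c) + Y(c)φ(a,b) is null for all a, b, c (`mem_gpVectors_gpDual_iff`), and [η_H]
is a quotient of [φ] exactly when η_H is a covector of [φ] (`isQuotientOf_iff`). If a lies in H \ F,
one term of the relation drops out and η_H becomes a multiple of φ(·,a) (`exists_eq_mul`): up to
scalars, the η_H are the columns of φ.

Consequently the Plücker relations of φ are dependences among the η_H (`linDep`). The rows of φ are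
determined up to scalars, and antisymmetry ties these scalars together, so [φ] is unique
(`exists_eq_unit_mul`). Moreover φ(a,b) = 0 exactly when some H contains both a and b
(`apply_eq_zero_iff`), which identifies the underlying matroid.

Conversely, given the dependences, one sets φ(a,b) = s(a)η_H(b) for a chosen H containing a.
Antisymmetry against a base point forces the scalars s(a); that φ is then antisymmetric everywhere
follows from two multiplicative identities (`mul_apply_comm`, `mul_apply_cyclic`). A Plücker
relation is a dependence of three rows whose coefficients are found by evaluating at zeros of those
rows. -/

namespace Tract

variable {T E ι : Type*} [Tract T]

/-! ### Signs and three-term null sums in a tract. -/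

theorem neg_spec (a : T) : ambient a + ambient (neg a) ∈ (nullset : Ideal (MonoidAlgebra ℕ Tˣ)) :=
  (existsUnique_neg a).choose_spec.1

theorem neg_unique {a b : T} (h : ambient a + ambient b ∈ (nullset : Ideal (MonoidAlgebra ℕ Tˣ))) :
    b = neg a :=
  (existsUnique_neg a).choose_spec.2 b h

theorem neg_one_mul (a : T) : neg 1 * a = neg a := by
  apply neg_unique
  have h := Ideal.mul_mem_left _ (ambient a) (neg_spec (1 : T))
  rwa [mul_add, ← ambient_mul, ← ambient_mul, mul_one, mul_comm] at h

theorem neg_one_mul_self : (neg 1 : T) * neg 1 = 1 := by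
  rw [neg_one_mul]
  refine (neg_unique ?_).symm
  rw [add_comm]
  exact neg_spec 1

@[simp] theorem neg_one_mul_cancel (a : T) : neg 1 * (neg 1 * a) = a := by
  rw [← mul_assoc, neg_one_mul_self, one_mul]

theorem neg_one_ne_zero : (neg 1 : T) ≠ 0 := by
  intro h
  have := neg_one_mul_self (T := T)
  simp [h] at this

/-- The formal sum of three elements lies in the nullset. -/
def Null3 (x y z : T) : Prop :=
  ambient x + ambient y + ambient z ∈ (nullset : Ideal (MonoidAlgebra ℕ Tˣ))

namespace Null3

theorem mul_left {x y z : T} (h : Null3 x y z) (u : T) : Null3 (u * x) (u * y) (u * z) := by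
  have := Ideal.mul_mem_left _ (ambient u) h
  simpa only [Null3, mul_add, ← ambient_mul] using this

theorem swap₁₂ {x y z : T} (h : Null3 x y z) : Null3 y x z := by
  unfold Null3 at *
  rwa [add_comm (ambient y)]

theorem swap₂₃ {x y z : T} (h : Null3 x y z) : Null3 x z y := by
  unfold Null3 at *
  rwa [add_right_comm]

theorem zero_right {x y : T} : Null3 x y 0 ↔ y = neg 1 * x := by
  rw [neg_one_mul]
  unfold Null3
  rw [ambient_zero, add_zero]
  exact ⟨neg_unique, by rintro rfl; exact neg_spec x⟩

theorem zero_mid {x y : T} : Null3 x 0 y ↔ y = neg 1 * x :=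
  ⟨fun h => zero_right.1 h.swap₂₃, fun h => (zero_right.2 h).swap₂₃⟩

theorem zero_left {x y : T} : Null3 0 x y ↔ y = neg 1 * x :=
  ⟨fun h => zero_mid.1 h.swap₁₂, fun h => (zero_mid.2 h).swap₁₂⟩

theorem iff_mul_left {x y z u : T} (hu : u ≠ 0) :
    Null3 (u * x) (u * y) (u * z) ↔ Null3 x y z :=
  ⟨fun h => by simpa [hu] using h.mul_left u⁻¹, fun h => h.mul_left u⟩

end Null3

/-! ### Rank-two functions and pencils of covectors. -/

/-- A rank two Grassmann-Plücker function, as a function of two variables. -/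
structure IsPlucker₂ (φ : E → E → T) : Prop where
  exists_ne_zero : ∃ a b, φ a b ≠ 0
  self : ∀ a, φ a a = 0
  swap : ∀ a b, φ b a = neg 1 * φ a b
  plucker : ∀ a b c d, Null3 (φ a b * φ c d) (neg 1 * (φ a c * φ b d)) (φ a d * φ b c)

/-- The condition that `Y` is a covector of the rank two Grassmann-Plücker function `φ`. -/
def IsCovector₂ (φ : E → E → T) (Y : E → T) : Prop :=
  ∀ a b c, Null3 (Y a * φ b c) (neg 1 * (Y b * φ a c)) (Y c * φ a b)

/-- Functions whose zero sets are the hyperplanes of a matroid that contain a given flat of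
corank two. -/
structure IsPencil (η : ι → E → T) : Prop where
  nontrivial : Nontrivial ι
  exists_zero : ∀ a, ∃ i, η i a = 0
  zero_of_ne : ∀ a i j, i ≠ j → η i a = 0 → η j a = 0 → ∀ k, η k a = 0
  exists_generic : ∀ i, ∃ a, η i a = 0 ∧ ∀ j, j ≠ i → η j a ≠ 0

namespace IsPencil

variable {η : ι → E → T} {φ ψ : E → E → T}

theorem exists_ne_zero (h : IsPencil η) (i : ι) : ∃ a, η i a ≠ 0 := by
  have := h.nontrivial
  obtain ⟨j, hj⟩ := exists_ne i
  obtain ⟨a, -, ha⟩ := h.exists_generic j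
  exact ⟨a, ha i hj.symm⟩

theorem apply_eq_zero (h : IsPencil η) (hη : ∀ i, IsCovector₂ φ (η i)) {i : ι} {a b : E}
    (ha : η i a = 0) (hb : η i b = 0) : φ a b = 0 := by
  obtain ⟨c, hc⟩ := h.exists_ne_zero i
  have := hη i a b c
  rw [ha, hb, zero_mul, zero_mul, mul_zero, Null3.zero_left, mul_zero, mul_eq_zero] at this
  exact this.resolve_left hc

/-- The covector relation at (x, y, a) loses its third term. This is what makes η i proportional to
φ(·,a). -/
theorem mul_apply_eq (hη : ∀ i, IsCovector₂ φ (η i)) {i : ι} {a : E}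
    (ha : η i a = 0) (x y : E) : η i x * φ y a = η i y * φ x a := by
  have := hη i x y a
  rw [ha, zero_mul, Null3.zero_right] at this
  exact (mul_left_cancel₀ neg_one_ne_zero this).symm

/-- If φ(a,b) = 0 without a common zero, the covector vanishing at a but not at b kills the whole
column φ(·,a). A covector nonzero at a then forces φ(c,d) = 0 for all c, d, a contradiction. -/
theorem apply_eq_zero_iff (h : IsPencil η) (hφ : IsPlucker₂ φ)
    (hη : ∀ i, IsCovector₂ φ (η i)) {a b : E} :
    φ a b = 0 ↔ ∃ i, η i a = 0 ∧ η i b = 0 := by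
  refine ⟨fun hab => ?_, fun ⟨i, ha, hb⟩ => h.apply_eq_zero hη ha hb⟩
  by_contra! hne
  obtain ⟨i, hi⟩ := h.exists_zero a
  obtain ⟨j, hj⟩ := h.exists_zero b
  have hib := hne i hi
  have hja : η j a ≠ 0 := fun h0 => hne j h0 hj
  have hb (c : E) : φ c b = 0 := by
    have := mul_apply_eq hη hj a c
    rw [hab, mul_zero] at this
    exact (mul_eq_zero.1 this).resolve_left hja
  have ha (c : E) : φ c a = 0 := by
    have := mul_apply_eq hη hi b c
    rw [hφ.swap a b, hab, mul_zero, mul_zero] at this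
    exact (mul_eq_zero.1 this).resolve_left hib
  obtain ⟨c, d, hcd⟩ := hφ.exists_ne_zero
  have := hη j a c d
  rw [hφ.swap d a, hφ.swap c a, ha, ha] at this
  simp only [mul_zero, Null3.zero_right] at this
  exact mul_ne_zero hja hcd ((mul_eq_zero.1 this.symm).resolve_left neg_one_ne_zero)

theorem exists_eq_mul (h : IsPencil η) (hφ : IsPlucker₂ φ) (hη : ∀ i, IsCovector₂ φ (η i))
    {i : ι} {a : E} (ha : η i a = 0) (ha' : ∀ j, j ≠ i → η j a ≠ 0) :
    ∃ μ : T, μ ≠ 0 ∧ ∀ x, η i x = μ * φ x a := by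
  obtain ⟨y, hy⟩ := h.exists_ne_zero i
  have hya : φ y a ≠ 0 := by
    rw [Ne, h.apply_eq_zero_iff hφ hη]
    rintro ⟨j, hjy, hja⟩
    have : j = i := by_contra fun hji => ha' j hji hja
    exact hy (this ▸ hjy)
  refine ⟨η i y / φ y a, div_ne_zero hy hya, fun x => ?_⟩
  rw [div_mul_eq_mul_div, eq_div_iff hya, mul_apply_eq hη ha]

end IsPencil

/-! ### From the rank-two function to dependence and uniqueness. -/

theorem linDep_three {X Y Z : E → T} :
    LinDep ![X, Y, Z] ↔ ∃ a b c : T, ¬ (a = 0 ∧ b = 0 ∧ c = 0) ∧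
      ∀ e, Null3 (a * X e) (b * Y e) (c * Z e) := by
  constructor
  · rintro ⟨c, hc, h⟩
    refine ⟨c 0, c 1, c 2, ?_, fun e => ?_⟩
    · rintro ⟨h0, h1, h2⟩
      apply hc
      ext i
      fin_cases i <;> assumption
    · simpa [Fin.sum_univ_three, Null3] using h e
  · rintro ⟨a, b, c, hne, h⟩
    refine ⟨![a, b, c], fun h0 => hne ?_, fun e => ?_⟩
    · exact ⟨congrFun h0 0, congrFun h0 1, congrFun h0 2⟩
    · simpa [Fin.sum_univ_three, Null3] using h e

namespace IsPencil

variable {η : ι → E → T} {φ ψ : E → E → T}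

/-- With generic points a, b, c of the three hyperplanes, the functions are multiples of φ(·,a),
φ(·,b), φ(·,c), and the Plücker relation for (e, a, b, c) is the dependence. Only φ(a,b) ≠ 0 is
needed for nontriviality, so k may coincide with i or j. -/
theorem linDep (h : IsPencil η) (hφ : IsPlucker₂ φ) (hη : ∀ i, IsCovector₂ φ (η i))
    {i j k : ι} (hij : i ≠ j) : LinDep ![η i, η j, η k] := by
  obtain ⟨a, ha, ha'⟩ := h.exists_generic i
  obtain ⟨b, hb, hb'⟩ := h.exists_generic j
  obtain ⟨c, hc, hc'⟩ := h.exists_generic k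
  obtain ⟨p, hp, hpa⟩ := h.exists_eq_mul hφ hη ha ha'
  obtain ⟨q, hq, hqb⟩ := h.exists_eq_mul hφ hη hb hb'
  obtain ⟨r, hr, hrc⟩ := h.exists_eq_mul hφ hη hc hc'
  have hab : φ a b ≠ 0 := by
    rw [Ne, h.apply_eq_zero_iff hφ hη]
    rintro ⟨l, hla, hlb⟩
    by_cases hl : l = i
    · exact hb' i hij (hl ▸ hlb)
    · exact ha' l hl hla
  refine linDep_three.2 ⟨φ b c / p, neg 1 * φ a c / q, φ a b / r,
    fun h0 => div_ne_zero hab hr h0.2.2, fun e => ?_⟩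
  convert hφ.plucker e a b c using 1
  · rw [hpa]; field_simp
  · rw [hqb]; field_simp
  · rw [hrc]; field_simp

/-- Rows at generic points agree up to a scalar, and antisymmetry equates the scalars of a and b
whenever φ(a,b) ≠ 0. Points of different classes satisfy this, and there are at least two classes,
so one scalar serves all rows. -/
theorem exists_eq_unit_mul (h : IsPencil η) (hφ : IsPlucker₂ φ) (hη : ∀ i, IsCovector₂ φ (η i))
    (hψ : IsPlucker₂ ψ) (hη' : ∀ i, IsCovector₂ ψ (η i)) :
    ∃ u : Tˣ, ∀ a b, ψ a b = u * φ a b := by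
  have key (a : E) (i : ι) (hi : η i a = 0) (hi' : ∀ j, j ≠ i → η j a ≠ 0) :
      ∃ u : T, u ≠ 0 ∧ ∀ x, ψ a x = u * φ a x := by
    obtain ⟨p, hp, hpa⟩ := h.exists_eq_mul hφ hη hi hi'
    obtain ⟨q, hq, hqa⟩ := h.exists_eq_mul hψ hη' hi hi'
    refine ⟨p / q, div_ne_zero hp hq, fun x => ?_⟩
    rw [div_mul_eq_mul_div, eq_div_iff hq, hψ.swap x a, hφ.swap x a, mul_comm, mul_left_comm,
      ← hqa, hpa, mul_left_comm]
  have key₂ (a b : E) (hab : φ a b ≠ 0) (u v : T) (hu : ∀ x, ψ a x = u * φ a x)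
      (hv : ∀ x, ψ b x = v * φ b x) : u = v := by
    have := hv a
    rw [hψ.swap a b, hu, hφ.swap a b, mul_left_comm] at this
    exact mul_right_cancel₀ (mul_ne_zero neg_one_ne_zero hab) this
  obtain ⟨i, j, hij⟩ := h.nontrivial
  obtain ⟨a, ha, ha'⟩ := h.exists_generic i
  obtain ⟨b, hb, hb'⟩ := h.exists_generic j
  obtain ⟨u, hu0, hu⟩ := key a i ha ha'
  obtain ⟨v, -, hv⟩ := key b j hb hb'
  have hne (c d : E) (k : ι) (hc : ∀ l, l ≠ k → η l c ≠ 0) (hd : η k d ≠ 0) : φ c d ≠ 0 := by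
    rw [Ne, h.apply_eq_zero_iff hφ hη]
    rintro ⟨l, hlc, hld⟩
    by_cases hl : l = k
    · exact hd (hl ▸ hld)
    · exact hc l hl hlc
  have huv : u = v := key₂ a b (hne a b i ha' (hb' i hij)) u v hu hv
  refine ⟨Units.mk0 u hu0, fun c d => ?_⟩
  rw [Units.val_mk0]
  obtain ⟨k, hk⟩ := h.exists_zero c
  by_cases hk' : ∀ l, l ≠ k → η l c ≠ 0
  · obtain ⟨w, -, hw⟩ := key c k hk hk'
    rw [hw]
    congr 1
    -- The reference point must lie in another class than c: b if c is in the class of a, and a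
    -- otherwise.
    by_cases hki : k = i
    · subst hki
      rw [huv]
      exact key₂ c b (hne c b k hk' (hb' k hij)) w v hw hv
    · exact key₂ c a (hne c a k hk' (ha' k hki)) w u hw hu
  -- Here c lies on two hyperplanes, hence on all of them, and both sides vanish.
  · push Not at hk'
    obtain ⟨l, hlk, hl⟩ := hk'
    have hF := h.zero_of_ne c l k hlk hl hk
    obtain ⟨m, hm⟩ := h.exists_zero d
    rw [h.apply_eq_zero hη (hF m) hm, h.apply_eq_zero hη' (hF m) hm, mul_zero]

/-! ### Construction of the rank-two function from dependent triples. -/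

/-- At a generic zero of one function the other two terms must cancel, so their coefficients vanish
together. Doing this for i and for j shows that no coefficient vanishes. -/
theorem exists_coeff (h : IsPencil η) {i j k : ι} (hij : i ≠ j) (hik : i ≠ k) (hjk : j ≠ k)
    (hd : LinDep ![η i, η j, η k]) : ∃ p q r : T, p ≠ 0 ∧ q ≠ 0 ∧ r ≠ 0 ∧
      ∀ e, Null3 (p * η i e) (q * η j e) (r * η k e) := by
  obtain ⟨p, q, r, hne, hn⟩ := linDep_three.1 hd
  have key {x y u v : T} (hu : u ≠ 0) (hv : v ≠ 0) (hxy : y * v = neg 1 * (x * u)) :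
      x = 0 ↔ y = 0 := by
    constructor
    · rintro rfl
      simpa [hv] using hxy
    · rintro rfl
      simpa [hu, neg_one_ne_zero.symm, eq_comm (a := (0 : T)), neg_one_ne_zero] using hxy
  obtain ⟨a, ha, ha'⟩ := h.exists_generic i
  obtain ⟨b, hb, hb'⟩ := h.exists_generic j
  have h1 := hn a
  have h2 := hn b
  rw [ha, mul_zero, Null3.zero_left] at h1
  rw [hb, mul_zero, Null3.zero_mid] at h2
  have h3 := key (ha' j hij.symm) (ha' k hik.symm) h1
  have h4 := key (hb' i hij) (hb' k hjk.symm) h2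
  refine ⟨p, q, r, ?_, ?_, ?_, hn⟩ <;> tauto

/-- All triples of functions in the family are linearly dependent. -/
def Modular (η : ι → E → T) : Prop :=
  ∀ i j k, i ≠ j → i ≠ k → j ≠ k → LinDep ![η i, η j, η k]

/-- On the zero set of η i, the dependence makes η k a fixed multiple of η j. -/
theorem mul_apply_comm (h : IsPencil η) (hd : Modular η) {i j k : ι} {a b : E} (ha : η i a = 0)
    (hb : η i b = 0) : η j a * η k b = η k a * η j b := by
  by_cases hij : i = j
  · subst hij; rw [ha, hb, zero_mul, mul_zero]
  by_cases hik : i = k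
  · subst hik; rw [ha, hb, zero_mul, mul_zero]
  by_cases hjk : j = k
  · subst hjk; rfl
  obtain ⟨p, q, r, hp, hq, hr, hn⟩ := h.exists_coeff hij hik hjk (hd i j k hij hik hjk)
  have h1 := hn a
  have h2 := hn b
  rw [ha, mul_zero, Null3.zero_left] at h1
  rw [hb, mul_zero, Null3.zero_left] at h2
  apply mul_left_cancel₀ (mul_ne_zero hr hq)
  calc r * q * (η j a * η k b) = q * η j a * (r * η k b) := by ac_rfl
    _ = r * η k a * (q * η j b) := by rw [h1, h2]; ac_rfl
    _ = _ := by ac_rfl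

/-- Each of a, b, c turns the dependence into a two-term relation. Multiplying the three cancels the
coefficients and leaves (-1)³ = -1. -/
theorem mul_apply_cyclic (h : IsPencil η) (hd : Modular η) {i j k : ι} (hij : i ≠ j) (hik : i ≠ k)
    (hjk : j ≠ k) {a b c : E} (ha : η i a = 0) (hb : η j b = 0) (hc : η k c = 0) :
    η i b * η j c * η k a = neg 1 * (η i c * η j a * η k b) := by
  obtain ⟨p, q, r, hp, hq, hr, hn⟩ := h.exists_coeff hij hik hjk (hd i j k hij hik hjk)
  have h1 := hn a
  have h2 := hn b
  have h3 := hn c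
  rw [ha, mul_zero, Null3.zero_left] at h1
  rw [hb, mul_zero, Null3.zero_mid] at h2
  rw [hc, mul_zero, Null3.zero_right] at h3
  apply mul_left_cancel₀ (mul_ne_zero (mul_ne_zero hp hq) hr)
  calc p * q * r * (η i b * η j c * η k a) = p * η i b * (q * η j c) * (r * η k a) := by ac_rfl
    _ = neg 1 * ((p * η i c) * (q * η j a) * (neg 1 * (p * η i b))) := by rw [h1, h3]; ac_rfl
    _ = neg 1 * ((p * η i c) * (q * η j a) * (r * η k b)) := by rw [h2]
    _ = _ := by ac_rfl

/-- A rescaling of the functions of a family is alternating if regarded as a function of two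
variables. -/
structure IsScaling (η : ι → E → T) (φ : E → E → T) : Prop where
  swap : ∀ a b, φ b a = neg 1 * φ a b
  exists_eq_mul : ∀ a, ∃ i, ∃ s : T, η i a = 0 ∧ (s = 0 → ∀ k, η k a = 0) ∧
    ∀ b, φ a b = s * η i b

/-- Normalizing the row of the base point o to be η i, antisymmetry against o forces s(a) = -η i a /
η (cl a) o outside the class of i. Inside that class, s(a) is the ratio η j a / η j o, which by
`mul_apply_comm` does not depend on j ≠ i. On the flat s is 0. -/
theorem exists_isScaling (h : IsPencil η) (hd : Modular η) : ∃ φ, IsScaling η φ := by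
  classical
  obtain ⟨i, j, hij⟩ := h.nontrivial
  obtain ⟨o, ho, ho'⟩ := h.exists_generic i
  choose cl hcl using h.exists_zero
  let s (a : E) : T := if ∀ k, η k a = 0 then 0 else
    if cl a = i then η j a / η j o else neg 1 * (η i a / η (cl a) o)
  have hs0 (a : E) (ha : ∀ k, η k a = 0) : s a = 0 := by simp only [s, if_pos ha]
  have hs1 (a : E) (ha : ¬ ∀ k, η k a = 0) (hi : cl a = i) : s a = η j a / η j o := by
    simp only [s, if_neg ha, if_pos hi]
  have hs2 (a : E) (ha : ¬ ∀ k, η k a = 0) (hi : cl a ≠ i) :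
      s a = neg 1 * (η i a / η (cl a) o) := by
    simp only [s, if_neg ha, if_neg hi]
  have hs3 (a : E) (ha : s a = 0) : ∀ k, η k a = 0 := by
    by_contra hF
    have hne (k : ι) (hk : k ≠ cl a) : η k a ≠ 0 := fun h0 =>
      hF (h.zero_of_ne a k (cl a) hk h0 (hcl a))
    by_cases hi : cl a = i
    · rw [hs1 a hF hi] at ha
      exact div_ne_zero (hne j (hi ▸ hij.symm)) (ho' j hij.symm) ha
    · rw [hs2 a hF hi] at ha
      exact mul_ne_zero neg_one_ne_zero (div_ne_zero (hne i (Ne.symm hi)) (ho' _ hi)) ha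
  have key (a b : E) (ha : ¬ ∀ k, η k a = 0) (hb : ¬ ∀ k, η k b = 0) (hai : cl a = i)
      (hbi : cl b ≠ i) : s b * η (cl b) a = neg 1 * (s a * η (cl a) b) := by
    rw [hs1 a ha hai, hs2 b hb hbi, hai, mul_assoc]
    congr 1
    have h1 := ho' j hij.symm
    have h2 := ho' _ hbi
    have h3 := h.mul_apply_comm hd (j := cl b) (k := j) (hai ▸ hcl a) ho
    rw [div_mul_eq_mul_div, div_mul_eq_mul_div, div_eq_div_iff h2 h1, mul_assoc, h3]
    ac_rfl
  refine ⟨fun a b => s a * η (cl a) b, fun a b => ?_, fun a => ⟨cl a, s a, hcl a, hs3 a,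
    fun b => rfl⟩⟩
  by_cases ha : ∀ k, η k a = 0
  · rw [hs0 a ha, ha]; simp
  by_cases hb : ∀ k, η k b = 0
  · rw [hs0 b hb, hb]; simp
  by_cases hab : cl a = cl b
  · rw [hab, hcl b, ← hab, hcl a]; simp
  by_cases hai : cl a = i
  · exact key a b ha hb hai (fun hbi => hab (hai.trans hbi.symm))
  by_cases hbi : cl b = i
  · rw [key b a hb ha hbi hai, neg_one_mul_cancel]
  have h1 := ho' _ hai
  have h2 := ho' _ hbi
  -- With both points outside the class of o, antisymmetry is the cyclic identity for o, a, b.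
  have h3 := h.mul_apply_cyclic hd (Ne.symm hai) (Ne.symm hbi) hab ho (hcl a) (hcl b)
  rw [hs2 a ha hai, hs2 b hb hbi, mul_assoc, mul_assoc]
  congr 1
  rw [div_mul_eq_mul_div, div_mul_eq_mul_div, ← mul_div_assoc, div_eq_div_iff h2 h1]
  calc η i b * η (cl b) a * η (cl a) o = neg 1 * (neg 1 * (η i b * η (cl a) o * η (cl b) a)) := by
        rw [neg_one_mul_cancel]; ac_rfl
    _ = _ := by rw [← h3]; ac_rfl

namespace IsScaling

theorem self_eq_zero (hs : IsScaling η φ) (a : E) : φ a a = 0 := by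
  obtain ⟨i, s, hi, -, h⟩ := hs.exists_eq_mul a
  rw [h, hi, mul_zero]

/-- The rows of b, c, d are multiples of three distinct functions of the family, hence dependent.
Evaluating at c and d fixes the coefficients, up to a common factor, as φ(c,d), -φ(b,d), φ(b,c);
evaluating at a gives the claim. -/
theorem plucker_of_ne_zero (hs : IsScaling η φ) (h : IsPencil η) (hd : Modular η) {a b c d : E}
    (hbc : φ b c ≠ 0) (hbd : φ b d ≠ 0) (hcd : φ c d ≠ 0) :
    Null3 (φ a b * φ c d) (neg 1 * (φ a c * φ b d)) (φ a d * φ b c) := by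
  obtain ⟨i, s, hi, -, hs1⟩ := hs.exists_eq_mul b
  obtain ⟨j, t, hj, -, ht1⟩ := hs.exists_eq_mul c
  obtain ⟨k, u, hk, -, hu1⟩ := hs.exists_eq_mul d
  have hdc : φ d c ≠ 0 := by rw [hs.swap c d]; exact mul_ne_zero neg_one_ne_zero hcd
  have hs0 : s ≠ 0 := by rintro rfl; exact hbc (by rw [hs1, zero_mul])
  have ht0 : t ≠ 0 := by rintro rfl; exact hcd (by rw [ht1, zero_mul])
  have hu0 : u ≠ 0 := by rintro rfl; exact hdc (by rw [hu1, zero_mul])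
  have hij : i ≠ j := by rintro rfl; exact hbc (by rw [hs1, hj, mul_zero])
  have hik : i ≠ k := by rintro rfl; exact hbd (by rw [hs1, hk, mul_zero])
  have hjk : j ≠ k := by rintro rfl; exact hcd (by rw [ht1, hk, mul_zero])
  obtain ⟨p, q, r, hp, hq, hr, hn⟩ := h.exists_coeff hij hik hjk (hd i j k hij hik hjk)
  have key (e : E) : Null3 (p / s * φ b e) (q / t * φ c e) (r / u * φ d e) := by
    convert hn e using 1
    · rw [hs1]; field_simp
    · rw [ht1]; field_simp
    · rw [hu1]; field_simp
  have h1 := key c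
  have h2 := key d
  rw [hs.self_eq_zero, mul_zero, Null3.zero_mid] at h1
  rw [hs.self_eq_zero, mul_zero, Null3.zero_right] at h2
  have h0 : neg 1 * (p / s) ≠ 0 := mul_ne_zero neg_one_ne_zero (div_ne_zero hp hs0)
  rw [← Null3.iff_mul_left h0]
  convert (key a).mul_left (φ c d) using 1
  · rw [hs.swap b a]
    calc neg 1 * (p / s) * (neg 1 * φ b a * φ c d)
        = neg 1 * (neg 1 * (φ c d * (p / s * φ b a))) := by ac_rfl
      _ = _ := neg_one_mul_cancel _
  · rw [hs.swap c a]
    calc neg 1 * (p / s) * (neg 1 * (neg 1 * φ c a * φ b d))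
        = neg 1 * (neg 1 * (neg 1 * (p / s * φ b d) * φ c a)) := by ac_rfl
      _ = q / t * φ c d * φ c a := by rw [neg_one_mul_cancel, h2]
      _ = _ := by ac_rfl
  · rw [hs.swap d a]
    calc neg 1 * (p / s) * (neg 1 * φ d a * φ b c)
        = neg 1 * (neg 1 * (p / s * φ b c)) * φ d a := by ac_rfl
      _ = r / u * φ c d * φ d a := by
          rw [← h1, hs.swap c d, mul_left_comm (r / u), neg_one_mul_cancel]
      _ = _ := by ac_rfl

/-- Either the rows of a and b are multiples of the same function, or one of these rows vanishes. In
each case the two remaining terms cancel. -/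
theorem plucker_of_eq_zero (hs : IsScaling η φ) (h : IsPencil η) {a b : E} (hab : φ a b = 0)
    (c d : E) :
    Null3 (φ a b * φ c d) (neg 1 * (φ a c * φ b d)) (φ a d * φ b c) := by
  rw [hab, zero_mul, Null3.zero_left, neg_one_mul_cancel]
  have hF (a b : E) (ha : ∀ k, η k a = 0) : φ b a = 0 := by
    obtain ⟨i, s, -, -, hb⟩ := hs.exists_eq_mul b
    rw [hb, ha, mul_zero]
  obtain ⟨i, s, hi, hs0, hs1⟩ := hs.exists_eq_mul a
  obtain ⟨j, t, hj, ht0, ht1⟩ := hs.exists_eq_mul b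
  rw [hs1, mul_eq_zero] at hab
  by_cases hij : i = j
  · subst hij
    rw [hs1, hs1, ht1, ht1]
    ac_rfl
  rcases hab with hs' | hb
  · rw [hs1, hs1, hs', zero_mul, zero_mul, zero_mul, zero_mul]
  · have hb' := h.zero_of_ne b i j hij hb hj
    rw [hs.swap c b, hs.swap d b, hF b c hb', hF b d hb']
    simp

/-- The relation is symmetric up to sign, so any vanishing value among b, c, d can be moved to the
first factor. -/
theorem plucker (hs : IsScaling η φ) (h : IsPencil η) (hd : Modular η) (a b c d : E) :
    Null3 (φ a b * φ c d) (neg 1 * (φ a c * φ b d)) (φ a d * φ b c) := by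
  have e (x y : T) : neg 1 * x * (neg 1 * y) = x * y := by
    rw [mul_mul_mul_comm, neg_one_mul_self, one_mul]
  by_cases hbc : φ b c = 0
  · have := hs.plucker_of_eq_zero h hbc a d
    rw [hs.swap a b, hs.swap a c, mul_assoc (neg 1), neg_one_mul_cancel, mul_left_comm (φ b d),
      mul_comm (φ b d), mul_comm (φ b c)] at this
    exact this.swap₁₂.swap₂₃
  by_cases hbd : φ b d = 0
  · have := hs.plucker_of_eq_zero h hbd a c
    rw [hs.swap a b, hs.swap c d, hs.swap a d, e, mul_left_comm (φ b c), mul_comm (φ b d),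
      mul_comm (φ b c)] at this
    rw [← Null3.iff_mul_left (neg_one_ne_zero (T := T)), neg_one_mul_cancel]
    exact this.swap₁₂
  by_cases hcd : φ c d = 0
  · have := hs.plucker_of_eq_zero h hcd a b
    rwa [hs.swap a c, hs.swap b d, hs.swap a d, hs.swap b c, e, e, mul_comm (φ c d),
      mul_comm (φ b c)] at this
  exact hs.plucker_of_ne_zero h hd hbc hbd hcd

theorem isPlucker₂ (hs : IsScaling η φ) (h : IsPencil η) (hd : Modular η) : IsPlucker₂ φ where
  exists_ne_zero := by
    obtain ⟨i, j, hij⟩ := h.nontrivial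
    obtain ⟨a, ha, ha'⟩ := h.exists_generic i
    obtain ⟨b, hb, hb'⟩ := h.exists_generic j
    obtain ⟨k, s, hk, hs0, hs1⟩ := hs.exists_eq_mul a
    refine ⟨a, b, ?_⟩
    have hki : k = i := by_contra fun hki => ha' k hki hk
    rw [hs1, hki]
    exact mul_ne_zero (fun h0 => ha' j hij.symm (hs0 h0 j)) (hb' i hij)
  self := hs.self_eq_zero
  swap := hs.swap
  plucker := hs.plucker h hd

/-- The row of a generic point o of the hyperplane is a nonzero multiple of η i, so the claim is a
Plücker relation with o as first entry. -/
theorem isCovector₂ (hs : IsScaling η φ) (h : IsPencil η) (hd : Modular η) (i : ι) :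
    IsCovector₂ φ (η i) := by
  intro a b c
  obtain ⟨o, ho, ho'⟩ := h.exists_generic i
  obtain ⟨k, s, hk, hs0, hs1⟩ := hs.exists_eq_mul o
  have hki : k = i := by_contra fun hki => ho' k hki hk
  have := h.nontrivial
  obtain ⟨j, hj⟩ := exists_ne i
  have hs' : s ≠ 0 := fun h0 => ho' j hj (hs0 h0 j)
  subst hki
  rw [← Null3.iff_mul_left hs']
  convert hs.plucker h hd o a b c using 1
  · rw [hs1, mul_assoc]
  · rw [hs1, mul_left_comm, mul_assoc]
  · rw [hs1, mul_assoc]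

end IsScaling

theorem exists_isPlucker₂ (h : IsPencil η) (hd : Modular η) :
    ∃ φ, IsPlucker₂ φ ∧ ∀ i, IsCovector₂ φ (η i) := by
  obtain ⟨φ, hs⟩ := h.exists_isScaling hd
  exact ⟨φ, hs.isPlucker₂ h hd, hs.isCovector₂ h hd⟩

end IsPencil
end Tract

/-! ### Signs, enumerations and the dual function. -/

namespace Tract

variable {T E : Type*} [Tract T]

theorem ofSign_one : ofSign T 1 = 1 := if_pos rfl

theorem ofSign_neg_one : ofSign T (-1) = neg 1 := if_neg (by decide)

theorem ofSign_mul (s t : ℤˣ) : ofSign T (s * t) = ofSign T s * ofSign T t := by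
  rcases Int.units_eq_one_or s with rfl | rfl <;> rcases Int.units_eq_one_or t with rfl | rfl <;>
    simp [ofSign_one, ofSign_neg_one, neg_one_mul_self]

theorem ofSign_mul_self (s : ℤˣ) : ofSign T s * ofSign T s = 1 := by
  rw [← ofSign_mul, Int.units_mul_self, ofSign_one]

theorem ofSign_neg (s : ℤˣ) : ofSign T (-s) = neg 1 * ofSign T s := by
  rw [← _root_.neg_one_mul s, ofSign_mul, ofSign_neg_one]

theorem ofSign_ne_zero (s : ℤˣ) : ofSign T s ≠ 0 := by
  intro h
  simpa [h] using ofSign_mul_self (T := T) s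

end Tract

theorem enumerationSign_comp_perm {E : Type*} [Fintype E] {m : ℕ} (f : Fin m → E)
    (hf : Function.Bijective f) (σ : Equiv.Perm (Fin m)) (h : Function.Bijective (f ∘ σ)) :
    enumerationSign (f ∘ σ) h = Equiv.Perm.sign σ * enumerationSign f hf := by
  have hm : Fintype.card E = m := by
    simpa using (Fintype.card_of_bijective hf).symm
  subst hm
  rw [mul_comm]
  unfold enumerationSign
  rw [← Equiv.Perm.sign_mul]
  exact congrArg _ (Equiv.ext fun _ => rfl)

theorem Fin.append_two {E : Type*} {h : 2 = 0 + 2} (x : Fin 0 → E) (a b : E) :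
    Fin.append x ![a, b] ∘ Fin.cast h = ![a, b] := by
  funext i
  fin_cases i <;> rfl

theorem Matrix.eta_vec_two {E : Type*} (e : Fin 2 → E) : e = ![e 0, e 1] := by
  funext i
  fin_cases i <;> rfl

namespace IsGrassmannPlucker

variable {T E : Type*} [Tract T]

/-- The choice in `gpDual` is harmless: two enumerations of the complement differ by a permutation,
whose sign enters both the enumeration sign and φ, and squares to 1. -/
theorem gpDual_apply [Fintype E] {r : ℕ} {φ : (Fin r → E) → T} (hφ : IsGrassmannPlucker φ)
    (d : Fin (Fintype.card E - r) → E) (e : Fin r → E) (h : Function.Bijective (Fin.append d e)) :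
    gpDual φ d = Tract.ofSign T (enumerationSign _ h) * φ e := by
  have hex : ∃ e : Fin r → E, Function.Bijective (Fin.append d e) := ⟨e, h⟩
  rw [gpDual, dif_pos hex]
  have key (e' : Fin r → E) (h' : Function.Bijective (Fin.append d e')) :
      Tract.ofSign T (enumerationSign _ h') * φ e' =
        Tract.ofSign T (enumerationSign _ h) * φ e := by
    have hσ (i : Fin r) : ∃ j, e j = e' i := by
      obtain ⟨j, hj⟩ := h.2 (e' i)
      induction j using Fin.addCases with
      | left j =>
        rw [Fin.append_left] at hj
        have := @h'.1 (Fin.castAdd r j) (Fin.natAdd _ i) (by simpa using hj)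
        simp [Fin.ext_iff] at this
        omega
      | right j => exact ⟨j, by simpa using hj⟩
    choose f hf using hσ
    have hinj : Function.Injective f := by
      intro i j hij
      have : e' i = e' j := by rw [← hf, ← hf, hij]
      have := @h'.1 (Fin.natAdd _ i) (Fin.natAdd _ j) (by simpa using this)
      simpa [Fin.ext_iff] using this
    let σ : Equiv.Perm (Fin r) := Equiv.ofBijective f (Finite.injective_iff_bijective.1 hinj)
    have he' : e' = e ∘ σ := funext fun i => (hf i).symm
    let τ : Equiv.Perm (Fin (Fintype.card E - r + r)) :=
      finSumFinEquiv.permCongr (Equiv.sumCongr 1 σ)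
    have happ : Fin.append d e' = Fin.append d e ∘ τ := by
      funext i
      induction i using Fin.addCases with
      | left j => simp [τ]
      | right j => simp [τ, he']
    have hsign : Equiv.Perm.sign τ = Equiv.Perm.sign σ := by
      simp [τ, Equiv.Perm.sign_permCongr, Equiv.Perm.sign_sumCongr]
    have : enumerationSign _ h' = Equiv.Perm.sign σ * enumerationSign _ h := by
      rw [← hsign]
      convert enumerationSign_comp_perm _ h τ (happ ▸ h') using 2
    rw [this, he', hφ.map_perm, Tract.ofSign_mul]
    calc _ = Tract.ofSign T (Equiv.Perm.sign σ) * Tract.ofSign T (Equiv.Perm.sign σ) *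
          (Tract.ofSign T (enumerationSign _ h) * φ e) := by ac_rfl
      _ = _ := by rw [Tract.ofSign_mul_self, one_mul]
  exact key _ _

theorem gpDual_of_not_injective [Fintype E] {r : ℕ} (φ : (Fin r → E) → T)
    {d : Fin (Fintype.card E - r) → E} (h : ¬ Function.Injective d) : gpDual φ d = 0 := by
  rw [gpDual, dif_neg]
  rintro ⟨e, he⟩
  apply h
  intro i j hij
  have := @he.1 (Fin.castAdd r i) (Fin.castAdd r j) (by simpa using hij)
  simpa [Fin.ext_iff] using this

variable {φ : (Fin 2 → E) → T}

theorem isPlucker₂ (hφ : IsGrassmannPlucker φ) : Tract.IsPlucker₂ (fun a b => φ ![a, b]) where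
  exists_ne_zero := by
    obtain ⟨_, e, he, -⟩ := hφ.exists_base
    exact ⟨e 0, e 1, by rwa [← Matrix.eta_vec_two]⟩
  self a := hφ.map_of_not_injective _ fun h => by
    have := @h 0 1 rfl
    simp at this
  swap a b := by
    have := hφ.map_perm (Equiv.swap 0 1) ![a, b]
    rw [Equiv.Perm.sign_swap (by decide), Tract.ofSign_neg_one] at this
    rw [← this]
    congr 1
    funext i
    fin_cases i <;> rfl
  plucker a b c d := by
    have := hφ.plucker 0 rfl ![] a b c d
    simp only [Fin.append_two] at this
    rw [Tract.neg_one_mul]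
    exact this

end IsGrassmannPlucker

/-! ### Functions of two variables as Grassmann-Plücker functions. -/

namespace Tract.IsPlucker₂

variable {T E : Type*} [Tract T] {φ : E → E → T}

theorem isGPBase_iff {B : Set E} :
    IsGPBase (fun e : Fin 2 → E => φ (e 0) (e 1)) B ↔ ∃ a b, φ a b ≠ 0 ∧ B = {a, b} := by
  constructor
  · rintro ⟨e, he, rfl⟩
    refine ⟨e 0, e 1, he, ?_⟩
    conv_lhs => rw [Matrix.eta_vec_two e]
    simp [Set.pair_comm]
  · rintro ⟨a, b, hab, rfl⟩
    exact ⟨![a, b], hab, by simp [Set.pair_comm]⟩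

theorem isGrassmannPlucker (hφ : IsPlucker₂ φ) :
    IsGrassmannPlucker (fun e : Fin 2 → E => φ (e 0) (e 1)) where
  exists_base := by
    obtain ⟨a, b, hab⟩ := hφ.exists_ne_zero
    exact ⟨_, isGPBase_iff.2 ⟨a, b, hab, rfl⟩⟩
  exchange := by
    have hs {a b : E} (h : φ a b ≠ 0) : φ b a ≠ 0 := by
      rw [hφ.swap a b]
      exact mul_ne_zero neg_one_ne_zero h
    have hne {a b : E} (h : φ a b ≠ 0) : a ≠ b := by
      rintro rfl
      exact h (hφ.self a)
    have key (a b c d : E) (hab : φ a b ≠ 0) (hcd : φ c d ≠ 0) (ha : a ∉ ({c, d} : Set E)) :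
        ∃ f ∈ ({c, d} : Set E) \ {a, b},
          IsGPBase (fun e : Fin 2 → E => φ (e 0) (e 1)) (insert f ({a, b} \ {a})) := by
      -- If neither c nor d could replace a, the Plücker relation would reduce to φ(a,b)φ(c,d) = 0.
      have hf : ∃ f ∈ ({c, d} : Set E), φ f b ≠ 0 := by
        by_contra! hf
        have := hφ.plucker a b c d
        rw [hφ.swap d b, hφ.swap c b, hf c (by simp), hf d (by simp)] at this
        simp only [mul_zero, Null3.zero_right] at this
        exact mul_ne_zero hab hcd ((mul_eq_zero.1 this.symm).resolve_left neg_one_ne_zero)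
      obtain ⟨f, hf, hfb⟩ := hf
      refine ⟨f, ⟨hf, ?_⟩, isGPBase_iff.2 ⟨f, b, hfb, ?_⟩⟩
      · rintro (rfl | rfl)
        · exact ha hf
        · exact hne hfb rfl
      · rw [Set.pair_sdiff_left (hne hab)]
    rintro X Y hX hY e ⟨heX, heY⟩
    obtain ⟨a, b, hab, rfl⟩ := isGPBase_iff.1 hX
    obtain ⟨c, d, hcd, rfl⟩ := isGPBase_iff.1 hY
    rcases heX with rfl | rfl
    · exact key _ b c d hab hcd heY
    · rw [Set.pair_comm a]
      exact key _ a c d (hs hab) hcd heY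
  map_perm σ e := by
    have hσ : ∀ σ : Equiv.Perm (Fin 2), σ = 1 ∨ σ = Equiv.swap 0 1 := by decide
    rcases hσ σ with rfl | rfl
    · simp [ofSign_one]
    · rw [Equiv.Perm.sign_swap (by decide), ofSign_neg_one]
      exact hφ.swap _ _
  map_of_not_injective e he := by
    have : e 0 = e 1 := by
      by_contra hne
      apply he
      intro i j hij
      fin_cases i <;> fin_cases j <;> simp_all
    rw [this]
    exact hφ.self _
  plucker k h x a b c d := by
    obtain rfl : k = 0 := by omega
    simp only [Fin.append_two]
    rw [← Tract.neg_one_mul]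
    exact hφ.plucker a b c d

end Tract.IsPlucker₂

/-! ### Covectors in rank two. -/

namespace IsGrassmannPlucker

variable {T E : Type*} [Tract T] [Fintype E] {φ : (Fin 2 → E) → T}

theorem bijective_append {N k : ℕ} (hN : Fintype.card E = N + 2) (h : N = k + 1) {i : Fin k → E}
    {a b c : E} (hs : ∀ e, e = a ∨ e = b ∨ e = c ∨ ∃ j, i j = e) :
    Function.Bijective (Fin.append (Fin.append i ![a] ∘ Fin.cast h) ![b, c]) := by
  rw [Fintype.bijective_iff_surjective_and_card]
  refine ⟨fun e => ?_, by simp [hN]⟩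
  subst h
  rcases hs e with rfl | rfl | rfl | ⟨j, rfl⟩
  · exact ⟨Fin.castAdd 2 (Fin.natAdd k 0), by simp⟩
  · exact ⟨Fin.natAdd (k + 1) 0, by simp⟩
  · exact ⟨Fin.natAdd (k + 1) 1, by simp⟩
  · exact ⟨Fin.castAdd 2 (Fin.castAdd 1 j), by simp⟩

theorem enumerationSign_swap_left {N k : ℕ} (h : N = k + 1) {i : Fin k → E} {a b c : E}
    (hb : Function.Bijective (Fin.append (Fin.append i ![a] ∘ Fin.cast h) ![b, c]))
    (hb' : Function.Bijective (Fin.append (Fin.append i ![b] ∘ Fin.cast h) ![a, c])) :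
    enumerationSign _ hb' = -enumerationSign _ hb := by
  subst h
  let p : Fin (k + 1 + 2) := Fin.castAdd 2 (Fin.natAdd k 0)
  let q : Fin (k + 1 + 2) := Fin.natAdd (k + 1) 0
  have hpq : p ≠ q := by simp [p, q, Fin.ext_iff]
  have : Fin.append (Fin.append i ![b] ∘ Fin.cast rfl) ![a, c] =
      Fin.append (Fin.append i ![a] ∘ Fin.cast rfl) ![b, c] ∘ Equiv.swap p q := by
    funext x
    rw [Function.comp_apply]
    by_cases hp : x = p
    · subst hp
      rw [Equiv.swap_apply_left]
      simp [p, q]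
    by_cases hq : x = q
    · subst hq
      rw [Equiv.swap_apply_right]
      simp [p, q]
    rw [Equiv.swap_apply_of_ne_of_ne hp hq]
    induction x using Fin.addCases with
    | left x =>
      induction x using Fin.addCases with
      | left x => simp
      | right x =>
        obtain rfl : x = 0 := Subsingleton.elim (α := Fin 1) _ _
        exact absurd rfl hp
    | right x =>
      fin_cases x
      · exact absurd rfl hq
      · simp
  have h2 := enumerationSign_comp_perm _ hb (Equiv.swap p q) (this ▸ hb')
  rw [Equiv.Perm.sign_swap hpq, neg_one_mul] at h2
  rw [← h2]
  congr 1

theorem enumerationSign_swap_right {N : ℕ} {d : Fin N → E} {a b : E}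
    (hb : Function.Bijective (Fin.append d ![a, b]))
    (hb' : Function.Bijective (Fin.append d ![b, a])) :
    enumerationSign _ hb' = -enumerationSign _ hb := by
  let p : Fin (N + 2) := Fin.natAdd N 0
  let q : Fin (N + 2) := Fin.natAdd N 1
  have hpq : p ≠ q := by simp [p, q, Fin.ext_iff]
  have : Fin.append d ![b, a] = Fin.append d ![a, b] ∘ Equiv.swap p q := by
    funext x
    rw [Function.comp_apply]
    induction x using Fin.addCases with
    | left x =>
      rw [Equiv.swap_apply_of_ne_of_ne (by simp [p, Fin.ext_iff]; omega)
        (by simp [q, Fin.ext_iff]; omega)]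
      simp
    | right x =>
      fin_cases x
      · change _ = Fin.append d ![a, b] (Equiv.swap p q p)
        rw [Equiv.swap_apply_left]
        simp [q]
      · change _ = Fin.append d ![a, b] (Equiv.swap p q q)
        rw [Equiv.swap_apply_right]
        simp [p]
  have h2 := enumerationSign_comp_perm _ hb (Equiv.swap p q) (this ▸ hb')
  rw [Equiv.Perm.sign_swap hpq, neg_one_mul] at h2
  rw [← h2]
  congr 1

/-- Only e = a, b, c contribute, since any other e repeats an entry of i. The three enumerations
differ by transpositions, which produces the signs +, -, + up to a common sign. -/
theorem orthogonal_gpDual_iff (hφ : IsGrassmannPlucker φ) {k : ℕ} (h : Fintype.card E - 2 = k + 1)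
    {i : Fin k → E} {a b c : E} (hs : ∀ e, e = a ∨ e = b ∨ e = c ∨ ∃ j, i j = e) (Y : E → T) :
    Tract.Orthogonal Y (fun e => gpDual φ (Fin.append i ![e] ∘ Fin.cast h)) ↔
      Tract.Null3 (Y a * φ ![b, c]) (Tract.neg 1 * (Y b * φ ![a, c])) (Y c * φ ![a, b]) := by
  classical
  have hN : Fintype.card E = Fintype.card E - 2 + 2 := by omega
  have hb₁ := bijective_append hN h hs
  have hb₂ := bijective_append hN h (i := i) (a := b) (b := a) (c := c)
    (fun e => by have := hs e; tauto)
  have hb₃ := bijective_append hN h (i := i) (a := c) (b := a) (c := b)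
    (fun e => by have := hs e; tauto)
  have hb₄ := bijective_append hN h (i := i) (a := a) (b := c) (c := b)
    (fun e => by have := hs e; tauto)
  have hne₁ {a b c : E}
      (hb : Function.Bijective (Fin.append (Fin.append i ![a] ∘ Fin.cast h) ![b, c])) : b ≠ c := by
    intro hbc
    have := @hb.1 (Fin.natAdd _ 0) (Fin.natAdd _ 1) (by simpa using hbc)
    simp [Fin.ext_iff] at this
  have hab := hne₁ hb₃
  have hac := hne₁ hb₂
  have hbc := hne₁ hb₁
  have hs₁ := enumerationSign_swap_left h hb₁ hb₂
  set s := enumerationSign _ hb₁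
  have h₁ : gpDual φ (Fin.append i ![a] ∘ Fin.cast h) = Tract.ofSign T s * φ ![b, c] :=
    hφ.gpDual_apply _ _ hb₁
  have h₂ : gpDual φ (Fin.append i ![b] ∘ Fin.cast h) =
      Tract.ofSign T s * (Tract.neg 1 * φ ![a, c]) := by
    rw [hφ.gpDual_apply _ _ hb₂, hs₁, Tract.ofSign_neg]
    ac_rfl
  have h₃ : gpDual φ (Fin.append i ![c] ∘ Fin.cast h) = Tract.ofSign T s * φ ![a, b] := by
    rw [hφ.gpDual_apply _ _ hb₃, enumerationSign_swap_left h hb₄ hb₃,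
      enumerationSign_swap_right hb₁ hb₄, neg_neg]
  have h₀ (e : E) (he : e ∉ ({a, b, c} : Finset E)) :
      gpDual φ (Fin.append i ![e] ∘ Fin.cast h) = 0 := by
    apply gpDual_of_not_injective
    intro hinj
    obtain ⟨j, rfl⟩ : ∃ j, i j = e := by
      have := hs e
      simp only [Finset.mem_insert, Finset.mem_singleton] at he
      tauto
    have := @hinj (Fin.cast h.symm (Fin.castAdd 1 j)) (Fin.cast h.symm (Fin.natAdd k 0)) (by simp)
    simp [Fin.ext_iff] at this
    omega
  unfold Tract.Orthogonal
  beta_reduce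
  rw [← Finset.sum_subset (Finset.subset_univ {a, b, c}) (fun e _ he => by
      rw [h₀ e he, mul_zero, ambient_zero]),
    Finset.sum_insert (by simp [hab, hac]), Finset.sum_pair hbc, h₁, h₂, h₃, ← add_assoc,
    ← Tract.Null3.iff_mul_left (Tract.ofSign_ne_zero s)]
  unfold Tract.Null3
  simp only [mul_left_comm]

/-- Injective tuples i correspond to their three-element complements {a, b, c}. Repetitions cost
nothing: with two of a, b, c equal the relation follows from antisymmetry, and for non-injective i
the dual vanishes. -/
theorem mem_gpVectors_gpDual_iff (hφ : IsGrassmannPlucker φ) {Y : E → T} :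
    Y ∈ gpVectors (gpDual φ) ↔ Tract.IsCovector₂ (fun a b => φ ![a, b]) Y := by
  classical
  constructor
  · intro hY a b c
    have hP := hφ.isPlucker₂
    have hself (a : E) : φ ![a, a] = 0 := hP.self a
    have hswap (a b : E) : φ ![b, a] = Tract.neg 1 * φ ![a, b] := hP.swap a b
    change Tract.Null3 (Y a * φ ![b, c]) (Tract.neg 1 * (Y b * φ ![a, c])) (Y c * φ ![a, b])
    by_cases hab : a = b
    · subst hab
      rw [hself, mul_zero, Tract.Null3.zero_right]
    by_cases hac : a = c
    · subst hac
      rw [hself, mul_zero, mul_zero, Tract.Null3.zero_mid, hswap a b, mul_left_comm,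
        Tract.neg_one_mul_cancel]
    by_cases hbc : b = c
    · subst hbc
      rw [hself, mul_zero, Tract.Null3.zero_left, Tract.neg_one_mul_cancel]
    let S : Finset E := {a, b, c}ᶜ
    have hS : S.card + 3 = Fintype.card E := by
      rw [← Finset.card_eq_three.2 ⟨a, b, c, hab, hac, hbc, rfl⟩, Finset.card_compl_add_card]
    rw [← hφ.orthogonal_gpDual_iff (k := S.card) (by omega) (i := fun j => S.equivFin.symm j)]
    · exact hY _ _ _
    · intro e
      by_cases he : e ∈ S
      · exact Or.inr (Or.inr (Or.inr ⟨S.equivFin ⟨e, he⟩, by simp⟩))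
      · simp only [S, Finset.mem_compl, Finset.mem_insert, Finset.mem_singleton, not_not] at he
        tauto
  · intro hY k h i
    by_cases hi : Function.Injective i
    · let S : Finset E := (Finset.univ.image i)ᶜ
      have hS : S.card = 3 := by
        have := Finset.card_compl_add_card (Finset.univ.image i)
        rw [Finset.card_image_of_injective _ hi, Finset.card_fin] at this
        change S.card + k = _ at this
        omega
      obtain ⟨a, b, c, -, -, -, habc⟩ := Finset.card_eq_three.1 hS
      rw [hφ.orthogonal_gpDual_iff h (a := a) (b := b) (c := c)]
      · exact hY a b c
      · intro e
        by_cases he : e ∈ S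
        · rw [habc] at he
          simp only [Finset.mem_insert, Finset.mem_singleton] at he
          tauto
        · simpa [S] using Or.inr (Or.inr (Or.inr (by simpa [S] using he)))
    · have h0 (e : E) : gpDual φ (Fin.append i ![e] ∘ Fin.cast h) = 0 := by
        apply gpDual_of_not_injective
        intro hinj
        apply hi
        intro x y hxy
        have := @hinj (Fin.cast h.symm (Fin.castAdd 1 x)) (Fin.cast h.symm (Fin.castAdd 1 y))
          (by simpa using hxy)
        simpa [Fin.ext_iff] using this
      unfold Tract.Orthogonal
      simp [h0, ambient_zero]

end IsGrassmannPlucker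

/-! ### Flats of corank two and contraction. -/

namespace Matroid

variable {E : Type*} {M : Matroid E}

theorem IsFlat.eq_of_subset_of_eRk_le [Finite E] {F G : Set E} (hF : M.IsFlat F) (hG : M.IsFlat G)
    (hFG : F ⊆ G) (h : M.eRk G ≤ M.eRk F) : F = G := by
  rw [← hF.closure, ← hG.closure]
  refine IsRkFinite.closure_eq_closure_of_subset_of_eRk_ge_eRk ?_ hFG h
  exact M.isRkFinite_of_finite F.toFinite

section

variable {F : Set E}

theorem IsFlatOfCorank.isHyperplane_closure_insert (hF : M.IsFlatOfCorank 2 F) {a : E}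
    (ha : a ∈ M.E \ F) : M.IsHyperplane (M.closure (insert a F)) := by
  refine ⟨M.isFlat_closure _, ?_⟩
  rw [eRk_closure_eq, eRk_insert_eq_add_one (by rwa [hF.1.closure]), ← hF.2, add_assoc]
  norm_num

theorem IsBasis.contract_isBase_iff {I B : Set E} (hI : M.IsBasis I F) :
    (M ／ F).IsBase B ↔ M.IsBase (B ∪ I) ∧ Disjoint F B := by
  rw [isBase_iff_maximal_indep]
  constructor
  · rintro ⟨hB, hmax⟩
    rw [hI.contract_indep_iff] at hB
    refine ⟨hB.1.isBase_of_forall_insert fun e he hins => he.2 (Or.inl ?_), hB.2⟩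
    have heF : e ∉ F := fun heF => he.2 <| Or.inr <| hI.mem_of_insert_indep heF <|
      hins.subset (Set.insert_subset_insert Set.subset_union_right)
    refine hmax ?_ (Set.subset_insert e B) (Set.mem_insert e B)
    rw [hI.contract_indep_iff, Set.insert_union]
    exact ⟨hins, Set.disjoint_insert_right.2 ⟨heF, hB.2⟩⟩
  · rintro ⟨hB, hd⟩
    refine ⟨hI.contract_indep_iff.2 ⟨hB.indep, hd⟩, fun J hJ hBJ x hx => ?_⟩
    rw [hI.contract_indep_iff] at hJ
    have := hB.eq_of_subset_indep hJ.1 (Set.union_subset_union_left I hBJ)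
    have hx' : x ∈ B ∪ I := this ▸ Or.inl hx
    exact hx'.resolve_right fun hxI => Set.disjoint_left.1 hJ.2 (hI.subset hxI) hx

theorem contractAddLoops_isBase_iff (hM : M.E = Set.univ) {B : Set E} :
    (M.contractAddLoops F).IsBase B ↔ (M ／ F).IsBase B := by
  rw [contractAddLoops, disjointSum_isBase_iff, loopyOn_isBase_iff, contract_ground, hM,
    loopyOn_ground, ← Set.disjoint_iff_inter_eq_empty]
  constructor
  · rintro ⟨h1, h2, -⟩
    rwa [Set.inter_eq_left.2] at h1
    exact fun x hx => ⟨trivial, fun hF => Set.disjoint_left.1 h2 hx hF⟩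
  · intro h
    have hs := h.subset_ground
    rw [contract_ground, hM] at hs
    rw [Set.inter_eq_left.2 hs]
    exact ⟨h, Set.disjoint_left.2 fun x hx => (hs hx).2, fun x hx => Or.inl (hs hx)⟩

variable [Finite E]

theorem eRank_ne_top (M : Matroid E) : M.eRank ≠ ⊤ :=
  (lt_of_le_of_lt M.eRank_le_encard_ground (Set.toFinite M.E).encard_lt_top).ne

theorem eRk_ne_top (M : Matroid E) (X : Set E) : M.eRk X ≠ ⊤ :=
  (lt_of_le_of_lt (M.eRk_le_eRank X) (lt_top_iff_ne_top.2 M.eRank_ne_top)).ne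

theorem IsFlatOfCorank.eRk_isHyperplane (hF : M.IsFlatOfCorank 2 F) {H : Set E}
    (hH : M.IsHyperplane H) : M.eRk H = M.eRk F + 1 := by
  have h1 := hF.2
  have h2 := hH.2
  rw [← h1] at h2
  have h3 := M.eRk_ne_top F
  have h4 := M.eRk_ne_top H
  lift M.eRk F to ℕ using h3 with m
  lift M.eRk H to ℕ using h4 with n
  norm_cast at h2 ⊢
  omega

/-- Since a alone determines H, distinct hyperplanes containing F share no element outside F. -/
theorem IsFlatOfCorank.eq_closure_insert (hF : M.IsFlatOfCorank 2 F) {H : Set E}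
    (hH : M.IsHyperplane H) (hFH : F ⊆ H) {a : E} (ha : a ∈ H) (haF : a ∉ F) :
    H = M.closure (insert a F) := by
  have haE : a ∈ M.E \ F := ⟨hH.1.subset_ground ha, haF⟩
  refine (IsFlat.eq_of_subset_of_eRk_le (M.isFlat_closure _) hH.1 ?_ ?_).symm
  · rw [← hH.1.closure]
    exact M.closure_subset_closure (Set.insert_subset ha hFH)
  · rw [hF.eRk_isHyperplane hH, hF.eRk_isHyperplane (hF.isHyperplane_closure_insert haE)]

theorem IsFlatOfCorank.exists_mem_of_isHyperplane (hF : M.IsFlatOfCorank 2 F) {H : Set E}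
    (hH : M.IsHyperplane H) : ∃ a ∈ H, a ∉ F := by
  by_contra! h
  have h1 := M.eRk_mono (show H ⊆ F from h)
  rw [hF.eRk_isHyperplane hH] at h1
  have h3 := M.eRk_ne_top F
  lift M.eRk F to ℕ using h3 with m
  norm_cast at h1
  omega

theorem IsFlatOfCorank.exists_notMem (hF : M.IsFlatOfCorank 2 F) : ∃ a ∈ M.E, a ∉ F := by
  by_contra! h
  have h1 := M.eRk_mono (show M.E ⊆ F from h)
  rw [eRk_ground, ← hF.2] at h1
  have h3 := M.eRk_ne_top F
  lift M.eRk F to ℕ using h3 with m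
  norm_cast at h1
  omega

theorem IsHyperplane.exists_notMem {H : Set E} (hH : M.IsHyperplane H) : ∃ a ∈ M.E, a ∉ H := by
  by_contra! h
  have h1 := M.eRk_mono (show M.E ⊆ H from h)
  rw [eRk_ground, ← hH.2] at h1
  have h3 := M.eRk_ne_top H
  lift M.eRk H to ℕ using h3 with m
  norm_cast at h1
  omega

/-- This describes the bases of M / F in the same terms as the nonvanishing of φ. The case a = b
takes care of itself: every element lies on some hyperplane containing F. -/
theorem IsFlatOfCorank.contract_isBase_iff (hF : M.IsFlatOfCorank 2 F) (hM : M.E = Set.univ)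
    {B : Set E} : (M ／ F).IsBase B ↔
      ∃ a b, B = {a, b} ∧ ∀ H, M.IsHyperplane H → F ⊆ H → ¬ (a ∈ H ∧ b ∈ H) := by
  obtain ⟨I, hI⟩ := M.exists_isBasis F hF.1.subset_ground
  have hsub (X : Set E) : X ⊆ M.E := hM ▸ Set.subset_univ X
  have hIr := hI.encard_eq_eRk
  have hIt : I.encard ≠ ⊤ := hIr ▸ M.eRk_ne_top F
  rw [hI.contract_isBase_iff]
  constructor
  · rintro ⟨hB, hd⟩
    have hcard := hB.encard_eq_eRank
    rw [Set.encard_union_eq (hd.symm.mono_right hI.subset), ← hF.2, ← hIr, add_comm] at hcard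
    have hB2 : B.encard = 2 := WithTop.add_left_cancel hIt hcard
    obtain ⟨a, b, -, rfl⟩ := Set.encard_eq_two.1 hB2
    refine ⟨a, b, rfl, fun H hH hFH ⟨ha, hb⟩ => ?_⟩
    obtain ⟨e, he, heH⟩ := hH.exists_notMem
    apply heH
    rw [← hH.1.closure]
    refine M.closure_subset_closure (X := {a, b} ∪ I) ?_ (hB.closure_eq ▸ he)
    exact Set.union_subset (Set.pair_subset ha hb) (hI.subset.trans hFH)
  · rintro ⟨a, b, rfl, h⟩
    have hins (c : E) (hc : c ∉ F) : c ∈ M.closure (insert c F) ∧ F ⊆ M.closure (insert c F) :=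
      Set.insert_subset_iff.1 (M.subset_closure _ (hsub _))
    have hH (c : E) (hc : c ∉ F) := hF.isHyperplane_closure_insert ⟨hsub _ (Set.mem_singleton c), hc⟩
    -- If a were in F, any hyperplane containing F and b would contain both elements.
    have key (a b : E) (h : ∀ H, M.IsHyperplane H → F ⊆ H → ¬ (a ∈ H ∧ b ∈ H)) : a ∉ F := by
      intro ha
      by_cases hb : b ∈ F
      · obtain ⟨o, -, ho⟩ := hF.exists_notMem
        exact h _ (hH o ho) (hins o ho).2 ⟨(hins o ho).2 ha, (hins o ho).2 hb⟩
      · exact h _ (hH b hb) (hins b hb).2 ⟨(hins b hb).2 ha, (hins b hb).1⟩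
    have ha := key a b h
    have hb := key b a fun H h1 h2 h3 => h H h1 h2 h3.symm
    have hb' : b ∉ M.closure (insert a I) := by
      rw [M.closure_insert_congr_right hI.closure_eq_closure]
      exact fun hb' => h _ (hH a ha) (hins a ha).2 ⟨(hins a ha).1, hb'⟩
    have ha' : a ∉ M.closure I := by rwa [hI.closure_eq_closure, hF.1.closure]
    have hai : M.Indep (insert a I) :=
      hI.indep.insert_indep_iff.2 (Or.inl ⟨hsub _ (Set.mem_singleton a), ha'⟩)
    have hbi : M.Indep (insert b (insert a I)) :=
      hai.insert_indep_iff.2 (Or.inl ⟨hsub _ (Set.mem_singleton b), hb'⟩)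
    have heq : ({a, b} ∪ I : Set E) = insert b (insert a I) := by
      rw [Set.insert_union, Set.singleton_union, Set.insert_comm]
    refine ⟨?_, ?_⟩
    · rw [heq]
      refine hbi.isBase_of_eRk_ge (Set.toFinite _) ?_
      rw [hbi.eRk_eq_encard, Set.encard_insert_of_notMem, Set.encard_insert_of_notMem, hIr, ← hF.2,
        add_assoc]
      · norm_num
      · exact fun h0 => ha (hI.subset h0)
      · exact fun h0 => hb' (M.subset_closure _ (hsub _) h0)
    · simp [ha, hb]

end

end Matroid

/-! ### The pencil of hyperplanes containing F. -/

namespace Tract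

variable {T E : Type*} [Tract T] {M : Matroid E} {F : Set E}

theorem isPencil_of_isHyperplaneFunction [Finite E] (hM : M.E = Set.univ)
    (hF : M.IsFlatOfCorank 2 F) {η : {H : Set E // M.IsHyperplane H ∧ F ⊆ H} → E → T}
    (hη : ∀ H, IsHyperplaneFunction M H.1 (η H)) : IsPencil η := by
  have hmem (H a) : η H a = 0 ↔ a ∈ H.1 := by
    have := Set.ext_iff.1 (hη H).2 a
    rw [Function.mem_support, Set.mem_compl_iff] at this
    tauto
  have hE (a : E) : a ∈ M.E := hM ▸ Set.mem_univ a
  have hex (a : E) (ha : a ∉ F) : ∃ H : {H : Set E // M.IsHyperplane H ∧ F ⊆ H}, a ∈ H.1 :=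
    ⟨⟨M.closure (insert a F), hF.isHyperplane_closure_insert ⟨hE a, ha⟩,
      (Set.subset_insert a F).trans (M.subset_closure _ (hM ▸ Set.subset_univ _))⟩,
      M.mem_closure_of_mem (Set.mem_insert a F) (hM ▸ Set.subset_univ _)⟩
  have huniq (a : E) (ha : a ∉ F) (H K : {H : Set E // M.IsHyperplane H ∧ F ⊆ H})
      (hH : a ∈ H.1) (hK : a ∈ K.1) : H = K :=
    Subtype.ext ((hF.eq_closure_insert H.2.1 H.2.2 hH ha).trans
      (hF.eq_closure_insert K.2.1 K.2.2 hK ha).symm)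
  obtain ⟨o, -, ho⟩ := hF.exists_notMem
  obtain ⟨H₀, hH₀⟩ := hex o ho
  refine ⟨?_, fun a => ?_, fun a H K hHK hH hK L => ?_, fun H => ?_⟩
  · obtain ⟨b, -, hb⟩ := H₀.2.1.exists_notMem
    obtain ⟨H₁, hH₁⟩ := hex b fun hbF => hb (H₀.2.2 hbF)
    exact ⟨H₀, H₁, by rintro rfl; exact hb hH₁⟩
  · by_cases ha : a ∈ F
    · exact ⟨H₀, (hmem _ _).2 (H₀.2.2 ha)⟩
    · obtain ⟨H, hH⟩ := hex a ha
      exact ⟨H, (hmem _ _).2 hH⟩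
  · by_cases ha : a ∈ F
    · exact (hmem _ _).2 (L.2.2 ha)
    · exact absurd (huniq a ha H K ((hmem _ _).1 hH) ((hmem _ _).1 hK)) hHK
  · obtain ⟨a, haH, haF⟩ := hF.exists_mem_of_isHyperplane H.2.1
    refine ⟨a, (hmem _ _).2 haH, fun K hKH hK => hKH ?_⟩
    exact huniq a haF K H ((hmem _ _).1 hK) haH

end Tract

/-! ### Quotients of rank one. -/

namespace TMatroid

variable {T E : Type*} [Tract T] [Fintype E]

theorem ofFunction_isBase_iff {X : E → T} (hX : X ≠ 0) {B : Set E} :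
    (ofFunction X hX).matroid.IsBase B ↔ ∃ e, X e ≠ 0 ∧ B = {e} := by
  change IsGPBase _ B ↔ _
  constructor
  · rintro ⟨e, he, rfl⟩
    exact ⟨e 0, he, Set.range_unique⟩
  · rintro ⟨e, he, rfl⟩
    exact ⟨fun _ => e, he, Set.range_const⟩

theorem ofFunction_loops {X : E → T} (hX : X ≠ 0) :
    (ofFunction X hX).matroid.loops = {e | X e = 0} := by
  ext e
  change (ofFunction X hX).matroid.IsLoop e ↔ _
  rw [Matroid.isLoop_iff_forall_notMem_isBase (show e ∈ Set.univ from trivial)]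
  constructor
  · intro h
    by_contra he
    exact h {e} ((ofFunction_isBase_iff hX).2 ⟨e, he, rfl⟩) rfl
  · intro he B hB
    obtain ⟨f, hf, rfl⟩ := (ofFunction_isBase_iff hX).1 hB
    rintro rfl
    exact hf he

theorem ofFunction_isHyperplane_iff {X : E → T} (hX : X ≠ 0) {H : Set E} :
    (ofFunction X hX).matroid.IsHyperplane H ↔ H = {e | X e = 0} := by
  have hB := @ofFunction_isBase_iff T E _ _ X hX
  rw [← ofFunction_loops hX]
  set M := (ofFunction X hX).matroid
  have hrank : M.eRank = 1 := by
    obtain ⟨e, he⟩ := Function.ne_iff.1 hX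
    rw [← (hB.2 ⟨e, he, rfl⟩).encard_eq_eRank, Set.encard_singleton]
  rw [Matroid.IsHyperplane, Matroid.IsFlatOfCorank, hrank]
  constructor
  · rintro ⟨hF, hr⟩
    have h0 : M.eRk H = 0 := by
      have := M.eRk_ne_top H
      lift M.eRk H to ℕ using this with n
      norm_cast at hr ⊢
      omega
    exact ((Matroid.eRk_eq_zero_iff hF.subset_ground).1 h0).antisymm hF.loops_subset
  · rintro rfl
    exact ⟨M.isFlat_closure _, by rw [Matroid.eRk_loops]; norm_num⟩

theorem covectors_smul {r : ℕ} {P : TMatroid T E r} {X : E → T} (hX : X ∈ P.covectors) (u : T) :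
    (fun e => u * X e) ∈ P.covectors := by
  induction P using Quotient.ind with
  | _ φ =>
  intro k h i
  have := Ideal.mul_mem_left _ (ambient u) (hX k h i)
  rw [Finset.mul_sum] at this
  unfold Tract.Orthogonal
  simpa only [← ambient_mul, mul_assoc] using this

/-- The matroid of X has the zero set of X as its only hyperplane, so a representation is a single
function. The fundamental relation makes it a multiple of X, and covectors are closed under scaling.
-/
theorem isQuotientOf_iff {r : ℕ} {P : TMatroid T E r} {X : E → T} (hX : X ≠ 0) :
    (ofFunction X hX).IsQuotientOf P ↔ X ∈ P.covectors := by
  obtain ⟨o, ho⟩ := Function.ne_iff.1 hX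
  have ho : X o ≠ 0 := ho
  constructor
  · rintro ⟨η, ⟨hrep, hrel⟩, hcov⟩
    let H : {H : Set E // (ofFunction X hX).matroid.IsHyperplane H} :=
      ⟨_, (ofFunction_isHyperplane_iff hX).2 rfl⟩
    have hsupp (e : E) : η H e ≠ 0 ↔ X e ≠ 0 := by
      have := Set.ext_iff.1 (hrep.hyperplaneFunction H).2 e
      exact this
    -- In rank one the hyperplane is spanned by the empty tuple.
    have hcl : (ofFunction X hX).matroid.closure (Set.range (Fin.elim0 : Fin 0 → E)) = H.1 := by
      rw [Set.range_eq_empty]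
      exact ofFunction_loops hX
    have h1 := covectors_smul (hcov ⟨H, rfl⟩) (X o / η H o)
    convert h1 using 1
    funext e
    by_cases he : X e = 0
    · have : η H e = 0 := by
        by_contra h
        exact (hsupp e).1 h he
      rw [he, this, mul_zero]
    · have h2 : η H e / η H o = X e / X o := hrel H 0 rfl Fin.elim0 hcl e he o ho
      have h3 := (hsupp o).2 ho
      rw [div_eq_div_iff h3 ho] at h2
      rw [div_mul_eq_mul_div, eq_div_iff h3, ← h2, mul_comm]
  · intro h
    refine ⟨fun _ => X, ⟨⟨fun H => ⟨H.2, ?_⟩, fun H₁ H₂ H₃ ⟨_, _, _, hne, _⟩ => ?_⟩, ?_⟩, ?_⟩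
    · rw [(ofFunction_isHyperplane_iff hX).1 H.2]
      rfl
    · exact absurd (((ofFunction_isHyperplane_iff hX).1 H₁.2).trans
        ((ofFunction_isHyperplane_iff hX).1 H₂.2).symm) hne
    · intro H k hk i _ d _ e _
      obtain rfl : k = 0 := by omega
      rfl
    · rintro _ ⟨_, rfl⟩
      exact h

end TMatroid

/-! ### Assembly of the main theorem. -/

theorem mainTheorem6 {T : Type*} [Tract T] (hT : Tract.IsPerfect T)
    {E : Type*} [Fintype E] (M : Matroid E) (hM : M.E = Set.univ)
    (F : Set E) (hF : M.IsFlatOfCorank 2 F)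
    (η : {H : Set E // M.IsHyperplane H ∧ F ⊆ H} → E → T)
    (hη : ∀ H, IsHyperplaneFunction M H.1 (η H)) :
    ((∀ H₁ H₂ H₃ : {H : Set E // M.IsHyperplane H ∧ F ⊆ H},
        M.IsModularTriple H₁.1 H₂.1 H₃.1 → H₁.1 ∩ H₂.1 ∩ H₃.1 = F →
          Tract.LinDep ![η H₁, η H₂, η H₃]) ↔
      ∃ P : TMatroid T E 2, ∀ H, (TMatroid.ofFunction (η H) (hη H).ne_zero).IsQuotientOf P) ∧
    (∀ P Q : TMatroid T E 2,
      (∀ H, (TMatroid.ofFunction (η H) (hη H).ne_zero).IsQuotientOf P) →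
      (∀ H, (TMatroid.ofFunction (η H) (hη H).ne_zero).IsQuotientOf Q) → P = Q) ∧
    (∀ P : TMatroid T E 2,
      (∀ H, (TMatroid.ofFunction (η H) (hη H).ne_zero).IsQuotientOf P) →
        P.matroid = M.contractAddLoops F) := by
  have hp := Tract.isPencil_of_isHyperplaneFunction hM hF hη
  have hmem (H a) : η H a = 0 ↔ a ∈ H.1 := by
    have := Set.ext_iff.1 (hη H).2 a
    rw [Function.mem_support, Set.mem_compl_iff] at this
    tauto
  have hcov (φ : GPFunction T E 2)
      (h : ∀ H, (TMatroid.ofFunction (η H) (hη H).ne_zero).IsQuotientOf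
        (Quotient.mk (gpSetoid T E 2) φ)) (H) :
      Tract.IsCovector₂ (fun a b => φ.1 ![a, b]) (η H) :=
    φ.2.mem_gpVectors_gpDual_iff.1 ((TMatroid.isQuotientOf_iff _).1 (h H))
  refine ⟨⟨fun h => ?_, ?_⟩, ?_, ?_⟩
  · have hd : Tract.IsPencil.Modular η := by
      intro H₁ H₂ H₃ h12 h13 h23
      -- Any three distinct members of the pencil form a modular triple, as two of them already meet
      -- in F.
      have hinter : H₁.1 ∩ H₂.1 ∩ H₃.1 = F := by
        refine subset_antisymm ?_ (Set.subset_inter (Set.subset_inter H₁.2.2 H₂.2.2) H₃.2.2)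
        rintro a ⟨⟨h1, h2⟩, -⟩
        by_contra ha
        exact h12 (Subtype.ext ((hF.eq_closure_insert H₁.2.1 H₁.2.2 h1 ha).trans
          (hF.eq_closure_insert H₂.2.1 H₂.2.2 h2 ha).symm))
      refine h H₁ H₂ H₃ ⟨H₁.2.1, H₂.2.1, H₃.2.1, ?_, ?_, ?_, hinter.symm ▸ hF⟩ hinter
      · exact fun h => h12 (Subtype.ext h)
      · exact fun h => h13 (Subtype.ext h)
      · exact fun h => h23 (Subtype.ext h)
    obtain ⟨φ, hφ, hY⟩ := hp.exists_isPlucker₂ hd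
    refine ⟨Quotient.mk (gpSetoid T E 2) ⟨_, hφ.isGrassmannPlucker⟩, fun H => ?_⟩
    exact (TMatroid.isQuotientOf_iff _).2 (hφ.isGrassmannPlucker.mem_gpVectors_gpDual_iff.2 (hY H))
  · rintro ⟨P, hP⟩ H₁ H₂ H₃ ⟨-, -, -, h12, -⟩ -
    induction P using Quotient.ind with
    | _ φ => exact hp.linDep φ.2.isPlucker₂ (hcov φ hP) (fun h => h12 (congrArg _ h))
  · intro P Q hP hQ
    induction P using Quotient.ind with
    | _ φ =>
    induction Q using Quotient.ind with
    | _ ψ =>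
    obtain ⟨u, hu⟩ := hp.exists_eq_unit_mul φ.2.isPlucker₂ (hcov φ hP) ψ.2.isPlucker₂ (hcov ψ hQ)
    refine Quotient.sound ⟨u, fun x => ?_⟩
    rw [Matrix.eta_vec_two x]
    exact hu _ _
  · intro P hP
    induction P using Quotient.ind with
    | _ φ =>
    refine Matroid.ext_isBase ?_ fun B _ => ?_
    · change Set.univ = _
      rw [Matroid.contractAddLoops, Matroid.disjointSum_ground_eq, Matroid.contract_ground,
        Matroid.loopyOn_ground, hM, Set.sdiff_union_self, Set.univ_union]
    · rw [Matroid.contractAddLoops_isBase_iff hM, hF.contract_isBase_iff hM]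
      change IsGPBase φ.1 B ↔ _
      have hzero (a b : E) : φ.1 ![a, b] = 0 ↔ ∃ H, η H a = 0 ∧ η H b = 0 :=
        hp.apply_eq_zero_iff φ.2.isPlucker₂ (hcov φ hP)
      -- Nonvanishing of φ at (a, b) is exactly the criterion for {a, b} to be a base of M / F.
      have hne (a b : E) : φ.1 ![a, b] ≠ 0 ↔
          ∀ H, M.IsHyperplane H → F ⊆ H → ¬ (a ∈ H ∧ b ∈ H) := by
        simp only [Ne, hzero, hmem, not_exists, Subtype.forall, and_imp]
      constructor
      · rintro ⟨e, he, rfl⟩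
        rw [Matrix.eta_vec_two e] at he ⊢
        exact ⟨e 0, e 1, by simp [Set.pair_comm], (hne _ _).1 he⟩
      · rintro ⟨a, b, rfl, h⟩
        exact ⟨![a, b], (hne _ _).2 h, by simp [Set.pair_comm]⟩
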